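/- Let $R$ be an injective von Neumann algebra on a complex Hilbert space $H$, let $\pi$ be a completely positive projection of $B(H)$ onto $R$, and let $\alpha$ be an action of a discrete group $G$ on $R$ by *-automorphisms. On $H\otimes\ell_2(G)$ put $L_g=I_H\otimes\lambda_g$ with $\lambda_g\delta_h=\delta_{gh}$, and $\Psi(r)=\sum_{g}\alpha_{g^{-1}}(r)\otimes e_{(g,g)}$ for $r\in R$; let $\mathcal L(R,\alpha,G)$ be the ultra-weak closure of $\mathrm{span}\{L_g\Psi(r): g\in G,\ r\in R\}$. For $x=\sum_{g,h} x_{(g,h)}\otimes e_{(g,h)}$ in $B(H\otimes \ell_2(G))$ let $\mathrm{Diag}(x)=\sum_g x_{(g,g)}\otimes e_{(g,g)}$, and write $y\sim\sum_g L_gc_g$ if the finite partial sums converge to $y$ in all the seminorms $p_\eta(z)=\|\mathrm{Diag}(z^*z)^{1/2}\eta\|$, $\eta \in H\otimes\ell_2(G)$. For a finite nonempty set $S\subseteq G$ let $\chi_S(g)=|S\cap gS|/|S|$, let $\xi_S=|S|^{-1/2}1_S=(k_g)_{g\in G}$ and $$\sigma_{\xi_S}(x)=\sum_{g,h\in G}L_{gh^{-1}}\Psi\big(\alpha_h(\pi(x_{(g,h)}))\big)\overline{k_g}\,k_h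 .$$ Let $(B_n)_{n\in\mathbb N}$ be any sequence of finite nonempty subsets of $G$ and write $\xi_n=\xi_{B_n}$. Every $\chi_{B_n}$ is positive definite, and every $\sigma_{\xi_n}$ is a unital, completely positive and $\Psi(R)$-bimodular map of $B(H\otimes\ell_2(G))$ into $\mathcal L(R,\alpha,G)$. There are a subnet $J\ni\iota\mapsto n(\iota)\in\mathbb N$, a function $\chi:G\to\mathbb R$ and a map $\sigma:B(H\otimes\ell_2(G))\to\mathcal L(R,\alpha,G)$ such that: * $\chi_{B_{n(\iota)}}\to\chi$ pointwise, and $\chi$ is positive definite, $\chi(g)\ge 0$ for all $g$, and $\chi(e)=1$; * $\sigma_{\xi_{n(\iota)}}(x)\to\sigma(x)$ ultra-weakly for every $x\in B(H\otimes\ell_2(G))$, and $\sigma$ is linear, unital, completely positive and $\Psi(R)$-bimodular; * (i) $\sigma(L_g\Psi(r))=\chi(g)L_g\Psi(r)$ for all $g\in G$, $r\in R$; * (ii) $\sigma$ restricts to the Hadamard multiplier $M^\chi$ on $\mathcal L(R,\alpha,G)$: for every $x\in\mathcal L(R,\alpha,G)$, with Fourier coefficients $x_g=\mathrm{Diag}(L_g^*x)$,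 one has $\sigma(x)\in \mathcal L(R,\alpha,G)$ and $\sigma(x)\sim\sum_g L_g\,\chi(g)x_g$; * (iii) $\|\sigma_{\xi_{n(\iota)}}(x)-\sigma(x)\|\to0$ for every $x$ in the norm closure of $\mathrm{span}\{L_g\Psi(r): g\in G,\ r\in R\}$; * (amenable case) if $(B_n)$ is a Følner sequence, i.e. $|tB_n\,\Delta\, B_n|/|B_n|\to0$ for every $t\in G$, then $\chi(g)=1$ for all $g$ and $\sigma$ is a completely positive conditional expectation of $B(H\otimes\ell_2(G))$ onto $\mathcal L(R,\alpha,G)$ (that is, $\sigma$ is the identity on $\mathcal L(R,\alpha,G)$ and $\sigma(axb)=a\sigma(x)b$ for $a,b\in\mathcal L(R,\alpha,G)$). -/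

import Mathlib

open Filter Topology
open scoped ComplexOrder CStarAlgebra

namespace CrossedProd

universe u v

/-- The Hilbert space `H ⊗ ℓ²(G)`, realised as the space `ℓ²(G, H)` of square summable functions
`G → H`; the elementary tensor `η ⊗ δ_g` is `lp.single 2 g η`. -/
abbrev L2 (H : Type u) [NormedAddCommGroup H] [InnerProductSpace ℂ H] (G : Type v) :
    Type (max u v) :=
  lp (fun _ : G => H) 2

theorem memlp_two_iff {H : Type u} [NormedAddCommGroup H] {G : Type v} (f : G → H) :
    Memℓp f 2 ↔ Summable fun g => ‖f g‖ ^ 2 := by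
  rw [memℓp_gen_iff (by norm_num)]
  simp

section Operators

variable {H : Type u} [NormedAddCommGroup H] [InnerProductSpace ℂ H] {G : Type v}

open Classical in
/-- The matrix entry `x_{(g,h)} ∈ B(H)` of an operator `x = ∑ x_{(g,h)} ⊗ e_{(g,h)}`
on `H ⊗ ℓ²(G)`. -/
noncomputable def entry (x : L2 H G →L[ℂ] L2 H G) (g h : G) : H →L[ℂ] H :=
  (lp.evalCLM ℂ (fun _ : G => H) 2 g) ∘L x ∘L
    (lp.singleContinuousLinearMap ℂ (fun _ : G => H) 2 h)

theorem norm_entry_apply_le (x : L2 H G →L[ℂ] L2 H G) (g h : G) (η : H) :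
    ‖entry x g h η‖ ≤ ‖x‖ * ‖η‖ := by
  classical
  have h1 : ‖entry x g h η‖ ≤ ‖x (lp.single 2 h η)‖ := by
    convert lp.norm_apply_le_norm (two_ne_zero) (x (lp.single 2 h η)) g
    simp [entry, lp.evalCLM]
  refine h1.trans ((x.le_opNorm _).trans ?_)
  rw [lp.norm_single (by norm_num)]

theorem norm_entry_le (x : L2 H G →L[ℂ] L2 H G) (g h : G) : ‖entry x g h‖ ≤ ‖x‖ :=
  ContinuousLinearMap.opNorm_le_bound _ x.opNorm_nonneg (norm_entry_apply_le x g h)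

theorem norm_sq_eq_tsum (f : L2 H G) : ‖f‖ ^ 2 = ∑' g, ‖f g‖ ^ 2 := by
  have := lp.norm_rpow_eq_tsum (p := 2) (by norm_num) f
  simpa using this

theorem diagonal_bound (a : G → H →L[ℂ] H) (C : ℝ) (ha : ∀ g, ‖a g‖ ≤ C) (f : L2 H G) (g : G) :
    ‖a g (f g)‖ ^ 2 ≤ C ^ 2 * ‖f g‖ ^ 2 := by
  rw [← mul_pow]
  gcongr
  exact (a g).le_of_opNorm_le (ha g) _

/-- The block diagonal operator `∑_g a_g ⊗ e_{(g,g)}` of a uniformly bounded family `(a_g)`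
in `B(H)`. -/
noncomputable def diagonalOp (a : G → H →L[ℂ] H) (C : ℝ) (ha : ∀ g, ‖a g‖ ≤ C) :
    L2 H G →L[ℂ] L2 H G :=
  LinearMap.mkContinuous
    { toFun := fun f => ⟨fun g => a g (f g), (memlp_two_iff _).2
        (((((memlp_two_iff _).1 (lp.memℓp f)).mul_left (C ^ 2))).of_nonneg_of_le
          (fun _ => by positivity) (diagonal_bound a C ha f))⟩
      map_add' := fun f f' => by ext g; exact map_add (a g) (f g) (f' g)
      map_smul' := fun c f => by ext g; exact map_smul (a g) c (f g) }
    |C| (fun f => by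
      refine le_of_sq_le_sq ?_ (by positivity)
      rw [norm_sq_eq_tsum, mul_pow, sq_abs, norm_sq_eq_tsum, ← tsum_mul_left]
      have hs := ((memlp_two_iff _).1 (lp.memℓp f)).mul_left (C ^ 2)
      exact (hs.of_nonneg_of_le (fun _ => by positivity)
        (diagonal_bound a C ha f)).tsum_le_tsum (diagonal_bound a C ha f) hs)

/-- The main diagonal `Diag(x) = ∑_g x_{(g,g)} ⊗ e_{(g,g)}`. -/
noncomputable def Diag (x : L2 H G →L[ℂ] L2 H G) : L2 H G →L[ℂ] L2 H G :=
  diagonalOp (fun g => entry x g g) ‖x‖ (fun g => norm_entry_le x g g)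

variable [Group G]

/-- The left translation `L_g = I_H ⊗ λ_g`, `(L_g f)(h) = f (g⁻¹ h)`, where `λ_g δ_h = δ_{gh}`. -/
noncomputable def leftOp (g : G) : L2 H G →L[ℂ] L2 H G :=
  LinearMap.mkContinuous
    { toFun := fun f => ⟨fun h => f (g⁻¹ * h), (memlp_two_iff _).2
        ((Equiv.mulLeft g⁻¹).summable_iff.2 ((memlp_two_iff _).1 (lp.memℓp f)))⟩
      map_add' := fun f f' => by ext h; rfl
      map_smul' := fun c f => by ext h; rfl }
    1 (fun f => by
      refine le_of_sq_le_sq ?_ (by positivity)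
      rw [norm_sq_eq_tsum, one_mul, norm_sq_eq_tsum]
      exact ((Equiv.mulLeft g⁻¹).tsum_eq (fun h => ‖f h‖ ^ 2)).le)

end Operators

section Ultraweak

variable (K : Type u) [NormedAddCommGroup K] [InnerProductSpace ℂ K]

/-- The ultra-weak topology on `B(K)`: the coarsest topology that makes all the functionals
`x ↦ ∑_n ⟨x ξ_n, η_n⟩` with `∑_n ‖ξ_n‖² < ∞` and `∑_n ‖η_n‖² < ∞` continuous. -/
@[reducible] noncomputable def ultraweak : TopologicalSpace (K →L[ℂ] K) :=
  TopologicalSpace.induced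
    (fun x (p : lp (fun _ : ℕ => K) 2 × lp (fun _ : ℕ => K) 2) =>
      ∑' n, inner ℂ (p.2 n) (x (p.1 n)))
    Pi.topologicalSpace

variable {K}

/-- Convergence `f → y` along `l` in the ultra-weak topology of `B(K)`. -/
def UltraweakTendsto {J : Type v} (f : J → K →L[ℂ] K) (l : Filter J) (y : K →L[ℂ] K) : Prop :=
  Tendsto f l (@nhds _ (ultraweak K) y)

end Ultraweak

section PositiveDefinite

variable {G : Type v} [Group G]

/-- A function `χ` on `G` is positive definite when all the matrices `(χ(g_i⁻¹ g_j))_{i,j}` are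
positive semidefinite. -/
def IsPositiveDefinite (χ : G → ℂ) : Prop :=
  ∀ (k : ℕ) (g : Fin k → G), (Matrix.of fun i j => χ ((g i)⁻¹ * g j)).PosSemidef

open Classical Pointwise in
/-- `χ_S(g) = |S ∩ gS| / |S|`. -/
noncomputable def chi (S : Finset G) (g : G) : ℝ :=
  ((S ∩ g • S).card : ℝ) / (S.card : ℝ)

/-- The normalised characteristic function `|S|^{-1/2} 1_S` of `S`, a unit vector of `ℓ²(G)` when
`S` is nonempty. -/
noncomputable def xi (S : Finset G) : G →₀ ℂ :=
  Finsupp.indicator S fun _ _ => ((Real.sqrt (S.card : ℝ))⁻¹ : ℂ)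

open Classical Pointwise in
/-- Følner sequence: `|tB_n Δ B_n| / |B_n| → 0` for every `t ∈ G`. -/
def IsFolnerSeq (B : ℕ → Finset G) : Prop :=
  ∀ t : G, Tendsto (fun n => ((symmDiff (t • B n) (B n)).card : ℝ) / ((B n).card : ℝ))
    atTop (𝓝 0)

end PositiveDefinite

section CrossedProduct

variable {H : Type u} [NormedAddCommGroup H] [InnerProductSpace ℂ H] [CompleteSpace H]

/-- A completely positive projection `π` of `B(H)` onto the von Neumann algebra `R`.
(`R` is injective exactly when such a `π` exists.) -/
structure CPProjection (R : VonNeumannAlgebra H) where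
  /-- the underlying completely positive map -/
  toCP : (H →L[ℂ] H) →CP (H →L[ℂ] H)
  mem' : ∀ x, toCP x ∈ R.toStarSubalgebra
  map_of_mem' : ∀ r ∈ R.toStarSubalgebra, toCP r = r

/-- `π(x)` as an element of `R`. -/
noncomputable def CPProjection.proj {R : VonNeumannAlgebra H} (π : CPProjection R)
    (x : H →L[ℂ] H) : R.toStarSubalgebra :=
  ⟨π.toCP x, π.mem' x⟩

variable {R : VonNeumannAlgebra H}

theorem isClosed_vonNeumann (R : VonNeumannAlgebra H) :
    IsClosed (R.toStarSubalgebra : Set (H →L[ℂ] H)) := by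
  have h : (R.toStarSubalgebra : Set (H →L[ℂ] H)) =
      Set.centralizer (Set.centralizer (R.toStarSubalgebra : Set (H →L[ℂ] H))) :=
    R.centralizer_centralizer'.symm
  rw [h]
  exact Set.isClosed_centralizer _

theorem norm_aut_le (β : R.toStarSubalgebra ≃⋆ₐ[ℂ] R.toStarSubalgebra)
    (r : R.toStarSubalgebra) : ‖(β r : H →L[ℂ] H)‖ ≤ ‖(r : H →L[ℂ] H)‖ := by
  have := isClosed_vonNeumann R
  exact NonUnitalStarAlgHom.norm_apply_le β r

variable {G : Type v} [Group G] (α : G →* (R.toStarSubalgebra ≃⋆ₐ[ℂ] R.toStarSubalgebra))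

/-- The representation `Ψ(r) = ∑_g α_{g⁻¹}(r) ⊗ e_{(g,g)}` of `R` on `H ⊗ ℓ²(G)`. -/
noncomputable def Psi (r : R.toStarSubalgebra) : L2 H G →L[ℂ] L2 H G :=
  diagonalOp (fun g => (α g⁻¹ r : H →L[ℂ] H)) ‖(r : H →L[ℂ] H)‖ (fun g => norm_aut_le (α g⁻¹) r)

/-- The linear span of the operators `L_g Ψ(r)`. -/
noncomputable def crossedSpan : Submodule ℂ (L2 H G →L[ℂ] L2 H G) :=
  Submodule.span ℂ {x | ∃ (g : G) (r : R.toStarSubalgebra), x = leftOp g * Psi α r}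

/-- The von Neumann crossed product `𝓛(R, α, G)`: the ultra-weak closure of the linear span of
the operators `L_g Ψ(r)`. -/
noncomputable def crossedProduct : Set (L2 H G →L[ℂ] L2 H G) :=
  @closure _ (ultraweak (L2 H G)) (crossedSpan α)

/-- The map
`σ_ξ(x) = ∑_{g,h} L_{gh⁻¹} Ψ(α_h(π(x_{(g,h)}))) \overline{k_g} k_h` for a finitely supported
vector `ξ = (k_g)` of `ℓ²(G)`. -/
noncomputable def sigmaMap (π : CPProjection R) (ξ : G →₀ ℂ) (x : L2 H G →L[ℂ] L2 H G) :
    L2 H G →L[ℂ] L2 H G :=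
  ∑ g ∈ ξ.support, ∑ h ∈ ξ.support,
    ((starRingEnd ℂ) (ξ g) * ξ h) • (leftOp (g * h⁻¹) * Psi α (α h (π.proj (entry x g h))))

/-- `T` is a (linear) unital, completely positive and `Ψ(R)`-bimodular mapping of
`B(H ⊗ ℓ²(G))` into `𝓛(R, α, G)`. -/
structure IsUCPBimodular (T : (L2 H G →L[ℂ] L2 H G) → (L2 H G →L[ℂ] L2 H G)) : Prop where
  cp : ∃ Φ : (L2 H G →L[ℂ] L2 H G) →CP (L2 H G →L[ℂ] L2 H G), ∀ x, Φ x = T x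
  unital : T 1 = 1
  mem : ∀ x, T x ∈ crossedProduct α
  left_mod : ∀ r x, T (Psi α r * x) = Psi α r * T x
  right_mod : ∀ r x, T (x * Psi α r) = T x * Psi α r

/-- `T` is a conditional expectation of `B(H ⊗ ℓ²(G))` onto `𝓛(R, α, G)`. -/
structure IsCondExp (T : (L2 H G →L[ℂ] L2 H G) → (L2 H G →L[ℂ] L2 H G)) : Prop where
  cp : ∃ Φ : (L2 H G →L[ℂ] L2 H G) →CP (L2 H G →L[ℂ] L2 H G), ∀ x, Φ x = T x
  mem : ∀ x, T x ∈ crossedProduct α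
  map_of_mem : ∀ x ∈ crossedProduct α, T x = x
  bimodular : ∀ a ∈ crossedProduct α, ∀ b ∈ crossedProduct α, ∀ x, T (a * x * b) = a * T x * b

end CrossedProduct

section Fourier

variable {H : Type u} [NormedAddCommGroup H] [InnerProductSpace ℂ H] [CompleteSpace H]
  {G : Type v} [Group G]

/-- The Fourier coefficient `x_g = Diag(L_g^* x)`. -/
noncomputable def fourierCoeff (x : L2 H G →L[ℂ] L2 H G) (g : G) : L2 H G →L[ℂ] L2 H G :=
  Diag (star (leftOp g : L2 H G →L[ℂ] L2 H G) * x)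

/-- `‖a^{1/2} ξ‖` for a positive operator `a` on a Hilbert space. -/
noncomputable def sqrtNorm {K : Type u} [NormedAddCommGroup K] [InnerProductSpace ℂ K]
    [CompleteSpace K] (a : K →L[ℂ] K) (ξ : K) : ℝ :=
  ‖CFC.sqrt a ξ‖

/-- The seminorm `p_ξ(x) = ‖Diag(x^* x)^{1/2} ξ‖`. -/
noncomputable def diagSeminorm (ξ : L2 H G) (x : L2 H G →L[ℂ] L2 H G) : ℝ :=
  sqrtNorm (Diag (star x * x)) ξ

/-- `y ∼ ∑_g L_g c_g`: the finite partial sums converge to `y` in all the seminorms `p_ξ`. -/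
def HasFourierSeries (y : L2 H G →L[ℂ] L2 H G) (c : G → (L2 H G →L[ℂ] L2 H G)) : Prop :=
  ∀ ξ : L2 H G, Tendsto (fun F : Finset G => diagSeminorm ξ (y - ∑ g ∈ F, leftOp g * c g))
    atTop (𝓝 0)

/-- `y = M^χ ⋆ x` for `x` in the crossed product: `y` is the element of the crossed product
with `y ∼ ∑_g χ(g) L_g x_g`, where `x ∼ ∑_g L_g x_g`. -/
def IsHadamardMultiple {R : VonNeumannAlgebra H}
    (α : G →* (R.toStarSubalgebra ≃⋆ₐ[ℂ] R.toStarSubalgebra)) (χ : G → ℂ)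
    (x y : L2 H G →L[ℂ] L2 H G) : Prop :=
  y ∈ crossedProduct α ∧ HasFourierSeries y (fun g => χ g • fourierCoeff x g)

end Fourier

end CrossedProd

/-!
Operators on `H ⊗ ℓ²(G)` are determined by their matrix entries, and everything is computed there.

*Complete positivity.* A matrix of operators is positive exactly when its quadratic form is
nonnegative (`CStarMatrix.sum_inner_nonneg`, `CStarMatrix.nonneg_of_sum_inner_nonneg`). Since
`L_{gh⁻¹} Ψ(α_h(r)) = L_g Ψ(r) L_h^*`, the map `σ_ξ` is the compression of the amplified completely
positive map `Ψ ∘ π`, applied to the matrix `(x_{(g,h)})`, by the column `(k_h L_h^*)`; hence it is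
completely positive. Bimodularity of `π` over `R`, and of the limit map over the crossed product in
the amenable case, comes from multiplicative domains (`cp_map_mul_of_map_star_mul_self`).

*Limits.* The functions `χ_{B_n}` take values in `[0, 1]` and the maps `σ_{ξ_n}` are contractions,
so along an ultrafilter on `ℕ` finer than `atTop` the former converge pointwise, and the latter
converge point-ultraweakly because bounded sets of operators are relatively ultra-weakly compact
(`exists_ultraweakTendsto`). An ultrafilter is turned into a subnet by indexing with its pointed
members. Positivity, linearity, bimodularity and the range condition pass to the limit.

*Hadamard multipliers.* The key formula is `σ_{ξ_S}(x)_{(s,t)} = χ_S(s t⁻¹) x_{(s,t)}` for `x` in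
the crossed product (`entry_sigmaMap_xi`). It rests on the covariance
`x_{(s,t)} = α_{t⁻¹}(x_{(s t⁻¹, e)})` of matrix entries, which is clear on the span of the operators
`L_g Ψ(r)`; to pass to the ultra-weak closure one needs that a `*`-automorphism `β` of a von Neumann
algebra has a closed graph for the weak operator topology (`aut_apply_of_tendsto`). That is where
the order structure enters: `β` preserves suprema of bounded chains, so for each vector `ζ` a
maximality argument produces, below any positive `e ≠ 0`, some `h² ≠ 0` with
`‖β(x h) ζ‖ ≤ ‖x h ξ‖` for all `x` (`exists_dominated`); the functionals `x ↦ ⟨η, β(x h²) ζ⟩` are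
then weakly continuous, and a second maximality argument shows that they separate points.
The formula for the entries passes to the limit and yields the action on generators, the Fourier
series of `σ(x)` and, when `χ = 1`, that `σ` is the identity on the crossed product.
-/

namespace CrossedProd

/-! ### Completely positive maps and their quadratic forms -/

section CStarAlgebra

variable {A : Type*} [NonUnitalCStarAlgebra A] [PartialOrder A] [StarOrderedRing A]

theorem exists_eq_star_mul_self {a : A} (ha : 0 ≤ a) : ∃ b, a = star b * b :=
  CStarAlgebra.nonneg_iff_eq_star_mul_self.1 ha

/-- For a self-adjoint `a`, the element `c = a⁻` satisfies `c a c = -c³`, and `a ≥ 0` as soon as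
`c³ = 0`. -/
theorem exists_negative_part {a : A} (ha : IsSelfAdjoint a) :
    ∃ c : A, 0 ≤ c ∧ c * a * c = -(c * c * c) ∧ (c * c * c = 0 → 0 ≤ a) := by
  have hneg : IsSelfAdjoint a⁻ := (CFC.negPart_nonneg a).isSelfAdjoint
  refine ⟨a⁻, CFC.negPart_nonneg a, ?_, fun h => ?_⟩
  · have h := congrArg (fun y => a⁻ * y * a⁻) (CFC.posPart_sub_negPart a ha)
    rw [← h, mul_sub, sub_mul, CFC.negPart_mul_posPart, zero_mul, zero_sub]
  · rw [← CFC.negPart_eq_zero_iff a ha]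
    have h2 : star (a⁻ * a⁻) * (a⁻ * a⁻) = 0 := by
      rw [star_mul, hneg.star_eq, ← mul_assoc, h, zero_mul]
    have h3 := (CStarRing.star_mul_self_eq_zero_iff _).1 h2
    refine (CStarRing.star_mul_self_eq_zero_iff _).1 ?_
    rw [hneg.star_eq, h3]

end CStarAlgebra

section CompletelyPositive

variable {K : Type*} [NormedAddCommGroup K] [InnerProductSpace ℂ K]

/-- The linear map on `K ⊕ ⋯ ⊕ K` given by a square matrix of operators on `K`. -/
noncomputable def blockOp {n : Type*} [Fintype n] (M : n → n → (K →L[ℂ] K)) :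
    PiLp 2 (fun _ : n => K) →ₗ[ℂ] PiLp 2 (fun _ : n => K) where
  toFun ξ := WithLp.toLp 2 fun i => ∑ j, M i j (ξ j)
  map_add' ξ ξ' := by ext i; simp [Finset.sum_add_distrib]
  map_smul' c ξ := by ext i; simp [Finset.smul_sum]

theorem inner_blockOp {n : Type*} [Fintype n] (M : n → n → (K →L[ℂ] K))
    (η ξ : PiLp 2 (fun _ : n => K)) :
    inner ℂ η (blockOp M ξ) = ∑ i, ∑ j, inner ℂ (η i) (M i j (ξ j)) := by
  simp [PiLp.inner_apply, blockOp, inner_sum]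

theorem inner_blockOp_single {n : Type*} [Fintype n] [DecidableEq n] (M : n → n → (K →L[ℂ] K))
    (i j : n) (η ξ : K) :
    inner ℂ (WithLp.toLp 2 (Pi.single i η) : PiLp 2 (fun _ : n => K))
      (blockOp M (WithLp.toLp 2 (Pi.single j ξ))) = inner ℂ η (M i j ξ) := by
  rw [inner_blockOp, Finset.sum_eq_single i, Finset.sum_eq_single j]
  · simp
  · intro b _ hb; simp [hb]
  · simp
  · intro b _ hb; simp [hb]
  · simp

theorem inner_self_nonneg_complex (v : K) : (0 : ℂ) ≤ inner ℂ v v :=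
  Complex.nonneg_iff.2 ⟨inner_self_nonneg (𝕜 := ℂ), (inner_self_im (𝕜 := ℂ) v).symm⟩

variable [CompleteSpace K]

/-- A Gram matrix `(∑ₖ N_{k,i}^* N_{k,j})` has a nonnegative quadratic form. -/
theorem CStarMatrix.sum_inner_nonneg {n : Type*} [Fintype n]
    {M : CStarMatrix n n (K →L[ℂ] K)} (hM : 0 ≤ M) (ξ : n → K) :
    0 ≤ ∑ i, ∑ j, inner ℂ (ξ i) (M i j (ξ j)) := by
  obtain ⟨N, rfl⟩ := exists_eq_star_mul_self hM
  have key : ∑ i, ∑ j, inner ℂ (ξ i) ((star N * N) i j (ξ j)) =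
      ∑ k, inner ℂ (∑ i, N k i (ξ i)) (∑ j, N k j (ξ j)) := by
    simp only [CStarMatrix.mul_apply, CStarMatrix.star_apply, sum_apply,
      mul_apply_eq_comp, inner_sum, sum_inner]
    simp only [ContinuousLinearMap.star_eq_adjoint, ContinuousLinearMap.adjoint_inner_right]
    rw [Finset.sum_congr rfl fun i _ => Finset.sum_comm, Finset.sum_comm]
    exact Finset.sum_congr rfl fun k _ => Finset.sum_comm
  rw [key]
  exact Finset.sum_nonneg fun k _ => inner_self_nonneg_complex _

/-- A matrix of operators with nonnegative quadratic form is positive: it is self-adjoint by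
polarization, and `(M⁻)³ = -M⁻ M M⁻` has both a nonnegative and a nonpositive quadratic form. -/
theorem CStarMatrix.nonneg_of_sum_inner_nonneg {n : Type*} [Fintype n]
    {M : CStarMatrix n n (K →L[ℂ] K)}
    (h : ∀ ξ : n → K, 0 ≤ ∑ i, ∑ j, inner ℂ (ξ i) (M i j (ξ j))) : 0 ≤ M := by
  classical
  have hsymm : (blockOp M).IsSymmetric := by
    rw [LinearMap.isSymmetric_iff_inner_map_self_real]
    intro v
    have := h v
    rw [← inner_blockOp M v v] at this
    rw [inner_conj_symm, ← inner_conj_symm (blockOp M v) v]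
    exact (Complex.conj_eq_iff_im.2 (Complex.nonneg_iff.1 this).2.symm).symm
  have hsa : IsSelfAdjoint M := by
    refine CStarMatrix.ext fun i j => ?_
    rw [CStarMatrix.star_apply, ContinuousLinearMap.star_eq_adjoint]
    refine ContinuousLinearMap.ext fun v => ext_inner_left ℂ fun w => ?_
    rw [ContinuousLinearMap.adjoint_inner_right, ← inner_blockOp_single M i j w v,
      ← hsymm, ← inner_conj_symm, ← inner_conj_symm (blockOp M _),
      inner_blockOp_single M j i v w]
  obtain ⟨c, hc, hcM, hc0⟩ := exists_negative_part hsa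
  refine hc0 ?_
  have h2 : 0 ≤ c * c * c := by
    have := star_left_conjugate_nonneg hc c
    rwa [hc.isSelfAdjoint.star_eq] at this
  have h3 : ∀ ξ : n → K, 0 ≤ ∑ i, ∑ j, inner ℂ (ξ i) ((c * M * c) i j (ξ j)) := by
    intro ξ
    have e : ∀ k i (v w : K), inner ℂ (c k i v) w = inner ℂ v (c i k w) := by
      intro k i v w
      rw [← ContinuousLinearMap.adjoint_inner_right, ← ContinuousLinearMap.star_eq_adjoint,
        ← CStarMatrix.star_apply, hc.isSelfAdjoint.star_eq]
    have := h (fun i => ∑ j, c i j (ξ j))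
    convert this using 1
    simp only [CStarMatrix.mul_apply, sum_apply,
      mul_apply_eq_comp, inner_sum, sum_inner, map_sum, Finset.sum_mul, e]
    calc _ = ∑ i, ∑ l, ∑ j, ∑ k, inner ℂ (ξ i) (c i k (M k l (c l j (ξ j)))) :=
          Finset.sum_congr rfl fun i _ => Finset.sum_comm
      _ = ∑ l, ∑ i, ∑ j, ∑ k, inner ℂ (ξ i) (c i k (M k l (c l j (ξ j)))) := Finset.sum_comm
      _ = ∑ l, ∑ i, ∑ k, ∑ j, inner ℂ (ξ i) (c i k (M k l (c l j (ξ j)))) :=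
          Finset.sum_congr rfl fun l _ => Finset.sum_congr rfl fun i _ => Finset.sum_comm
      _ = ∑ l, ∑ k, ∑ i, ∑ j, inner ℂ (ξ i) (c i k (M k l (c l j (ξ j)))) :=
          Finset.sum_congr rfl fun l _ => Finset.sum_comm
      _ = ∑ k, ∑ l, ∑ i, ∑ j, inner ℂ (ξ i) (c i k (M k l (c l j (ξ j)))) := Finset.sum_comm
      _ = _ := Finset.sum_congr rfl fun k _ => Finset.sum_congr rfl fun l _ => Finset.sum_comm
  have h4 : blockOp (c * c * c) = 0 := by
    rw [← inner_map_self_eq_zero]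
    intro v
    have a1 := CStarMatrix.sum_inner_nonneg h2 v
    have a2 := h3 v
    rw [hcM] at a2
    simp only [CStarMatrix.neg_apply, neg_apply, inner_neg_right,
      Finset.sum_neg_distrib, Left.nonneg_neg_iff] at a2
    rw [← inner_conj_symm, inner_blockOp (c * c * c) v v, le_antisymm a2 a1, map_zero]
  refine CStarMatrix.ext fun i j => ContinuousLinearMap.ext fun v =>
    ext_inner_left ℂ fun w => ?_
  rw [← inner_blockOp_single (c * c * c) i j w v, h4]
  simp

/-- A linear map all of whose amplifications have nonnegative quadratic forms on positive
matrices is completely positive. -/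
noncomputable def cpOfForm (T : (K →L[ℂ] K) →ₗ[ℂ] (K →L[ℂ] K))
    (hT : ∀ (k : ℕ) (M : CStarMatrix (Fin k) (Fin k) (K →L[ℂ] K)), 0 ≤ M → ∀ ξ : Fin k → K,
      0 ≤ ∑ i, ∑ j, inner ℂ (ξ i) (T (M i j) (ξ j))) :
    (K →L[ℂ] K) →CP (K →L[ℂ] K) where
  toLinearMap := T
  map_cstarMatrix_nonneg' k M hM := CStarMatrix.nonneg_of_sum_inner_nonneg (hT k M hM)

/-- The quadratic form of the matrix `(Φ(a_i^* a_j))` is nonnegative for `Φ` completely positive. -/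
theorem cp_gram_nonneg {n : Type*} [Fintype n] (Φ : (K →L[ℂ] K) →CP (K →L[ℂ] K))
    (a : n → (K →L[ℂ] K)) (ξ : n → K) :
    0 ≤ ∑ i, ∑ j, inner ℂ (ξ i) (Φ (star (a i) * a j) (ξ j)) := by
  have h : (0 : CStarMatrix n n (K →L[ℂ] K)) ≤
      CStarMatrix.ofMatrix fun i j => star (a i) * a j := by
    refine CStarMatrix.nonneg_of_sum_inner_nonneg fun η => ?_
    have : ∑ i, ∑ j, inner ℂ (η i) ((star (a i) * a j) (η j)) =
        inner ℂ (∑ i, a i (η i)) (∑ j, a j (η j)) := by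
      simp only [mul_apply_eq_comp, inner_sum, sum_inner,
        ContinuousLinearMap.star_eq_adjoint, ContinuousLinearMap.adjoint_inner_right]
      exact Finset.sum_comm
    exact (inner_self_nonneg_complex _).trans_eq this.symm
  exact CStarMatrix.sum_inner_nonneg (Φ.map_cstarMatrix_nonneg _ h) ξ

theorem cp_map_star (Φ : (K →L[ℂ] K) →CP (K →L[ℂ] K)) (a : K →L[ℂ] K) :
    Φ (star a) = star (Φ a) := map_star Φ a

/-- An element `a` with `Φ(a^* a) = Φ(a)^* Φ(a)` is in the multiplicative domain of the unital
completely positive map `Φ`: the positive sesquilinear form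
`(b, η), (a, ξ) ↦ ⟨η, (Φ(b^* a) - Φ(b)^* Φ(a)) ξ⟩` vanishes at `(a, ξ)`. -/
theorem cp_map_mul_of_map_star_mul_self (Φ : (K →L[ℂ] K) →CP (K →L[ℂ] K)) (h1 : Φ 1 = 1)
    {a : K →L[ℂ] K} (ha : Φ (star a * a) = star (Φ a) * Φ a) (b : K →L[ℂ] K) :
    Φ (b * a) = Φ b * Φ a := by
  have hform : ∀ (η ξ : K), 0 ≤
      inner ℂ η ((Φ (b * star b) - Φ b * star (Φ b)) η) +
      (inner ℂ η ((Φ (b * a) - Φ b * Φ a) ξ) + 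
      (starRingEnd ℂ) (inner ℂ η ((Φ (b * a) - Φ b * Φ a) ξ))) := by
    intro η ξ
    -- completing the square: the vector paired with `1` removes the terms in `Φ(b)^*` and `Φ(a)`
    have := cp_gram_nonneg Φ ![1, star b, a] ![-(star (Φ b) η + Φ a ξ), η, ξ]
    simp only [Fin.sum_univ_three, Matrix.cons_val_zero, Matrix.cons_val_one, Matrix.cons_val,
      star_one, one_mul, mul_one, h1, star_star, cp_map_star, ha] at this
    convert this using 1
    have e1 : Φ (star a * star b) = star (Φ (b * a)) := by rw [← cp_map_star, star_mul]
    rw [inner_conj_symm, e1]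
    simp only [sub_apply, mul_apply_eq_comp, one_apply_eq_self,
      ContinuousLinearMap.star_eq_adjoint, inner_sub_left,
      inner_sub_right, inner_add_left, inner_add_right, inner_neg_left, inner_neg_right,
      ContinuousLinearMap.adjoint_inner_right, ContinuousLinearMap.adjoint_inner_left, map_neg,
      map_add]
    ring
  have hz : ∀ η ξ : K, inner ℂ η ((Φ (b * a) - Φ b * Φ a) ξ) = 0 := by
    intro η ξ
    set z := inner ℂ η ((Φ (b * a) - Φ b * Φ a) ξ) with hz
    set d := inner ℂ η ((Φ (b * star b) - Φ b * star (Φ b)) η) with hd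
    -- scaling `ξ` by `-t z̄` shows that the linear term of the form vanishes
    have h2 : ∀ t : ℝ, 0 ≤ d.re - 2 * t * ‖z‖ ^ 2 := by
      intro t
      have := hform η ((-(t : ℂ) * (starRingEnd ℂ) z) • ξ)
      rw [map_smul, inner_smul_right, ← hz, ← hd] at this
      have := (Complex.nonneg_iff.1 this).1
      have e : (-(t : ℂ) * (starRingEnd ℂ) z) * z = ((-t * ‖z‖ ^ 2 : ℝ) : ℂ) := by
        rw [mul_assoc, mul_comm _ z, Complex.mul_conj, Complex.normSq_eq_norm_sq]; push_cast; ring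
      rw [e, Complex.conj_ofReal] at this
      simp only [Complex.add_re, Complex.ofReal_re] at this
      linarith
    by_contra hne
    have hpos : 0 < ‖z‖ ^ 2 := by positivity
    have := h2 ((d.re + 1) / (2 * ‖z‖ ^ 2))
    field_simp at this
    linarith
  rw [← sub_eq_zero]
  exact ContinuousLinearMap.ext fun ξ => ext_inner_left ℂ fun η => by
    rw [hz]; simp

theorem cp_map_mul_of_map_mul_star_self (Φ : (K →L[ℂ] K) →CP (K →L[ℂ] K)) (h1 : Φ 1 = 1)
    {a : K →L[ℂ] K} (ha : Φ (a * star a) = Φ a * star (Φ a)) (b : K →L[ℂ] K) :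
    Φ (a * b) = Φ a * Φ b := by
  have := cp_map_mul_of_map_star_mul_self Φ h1 (a := star a)
    (by rw [star_star, cp_map_star, star_star, ha]) (star b)
  rw [← star_mul, cp_map_star, cp_map_star, cp_map_star, ← star_mul] at this
  exact star_injective this

/-- Unital completely positive maps are contractive, by the Kadison-Schwarz inequality
`‖Φ(x) ξ‖² ≤ ⟨ξ, Φ(x^* x) ξ⟩`. -/
theorem ucp_norm_le (Φ : (K →L[ℂ] K) →CP (K →L[ℂ] K)) (h1 : Φ 1 = 1) (x : K →L[ℂ] K) :
    ‖Φ x‖ ≤ ‖x‖ := by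
  refine ContinuousLinearMap.opNorm_le_bound _ (norm_nonneg _) fun ξ => ?_
  have hg := cp_gram_nonneg Φ ![1, x] ![-(Φ x ξ), ξ]
  simp only [Fin.sum_univ_two, Matrix.cons_val_zero, Matrix.cons_val_one, star_one, one_mul,
    mul_one, h1, cp_map_star] at hg
  have hle : Φ (star x * x) ≤ ((‖x‖ ^ 2 : ℝ) : ℂ) • 1 := by
    have h2 : star x * x ≤ ((‖x‖ ^ 2 : ℝ) : ℂ) • 1 := by
      have := IsSelfAdjoint.le_algebraMap_norm_self (a := star x * x)
        (IsSelfAdjoint.star_mul_self x)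
      rwa [CStarRing.norm_star_mul_self, ← sq, Algebra.algebraMap_eq_smul_one] at this
    have := OrderHomClass.mono Φ h2
    rwa [map_smul, h1] at this
  have h3 := ((ContinuousLinearMap.le_def _ _).1 hle).re_inner_nonneg_right ξ
  have h4 := (Complex.nonneg_iff.1 hg).1
  have e1 : inner ℂ ξ (star (Φ x) (-Φ x ξ)) = -((‖Φ x ξ‖ ^ 2 : ℝ) : ℂ) := by
    rw [ContinuousLinearMap.star_eq_adjoint, ContinuousLinearMap.adjoint_inner_right,
      inner_neg_right, inner_self_eq_norm_sq_to_K]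
    norm_cast
  have e2 : inner ℂ ξ ((((‖x‖ ^ 2 : ℝ) : ℂ) • (1 : K →L[ℂ] K)) ξ) =
      ((‖x‖ ^ 2 * ‖ξ‖ ^ 2 : ℝ) : ℂ) := by
    rw [smul_apply, one_apply_eq_self, inner_smul_right, inner_self_eq_norm_sq_to_K]
    push_cast
    rfl
  rw [e1, one_apply_eq_self, inner_neg_neg, inner_neg_left, add_neg_cancel, zero_add] at h4
  rw [sub_apply, inner_sub_right, map_sub, e2] at h3
  refine le_of_sq_le_sq ?_ (by positivity)
  rw [mul_pow]
  simp only [Complex.add_re, Complex.neg_re, Complex.ofReal_re, RCLike.re_eq_complex_re] at h3 h4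
  linarith

end CompletelyPositive

/-! ### The ultra-weak topology -/

section UltraweakTopology

variable {K : Type*} [NormedAddCommGroup K] [InnerProductSpace ℂ K]

theorem ultraweakTendsto_iff {J : Type*} {f : J → K →L[ℂ] K} {l : Filter J} {y : K →L[ℂ] K} :
    UltraweakTendsto f l y ↔ ∀ p : lp (fun _ : ℕ => K) 2 × lp (fun _ : ℕ => K) 2,
      Tendsto (fun j => ∑' n, inner ℂ (p.2 n) (f j (p.1 n))) l
        (𝓝 (∑' n, inner ℂ (p.2 n) (y (p.1 n)))) := by
  unfold UltraweakTendsto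
  rw [nhds_induced, tendsto_comap_iff, tendsto_pi_nhds]
  rfl

theorem UltraweakTendsto.tendsto_inner {J : Type*} {f : J → K →L[ℂ] K} {l : Filter J}
    {y : K →L[ℂ] K} (h : UltraweakTendsto f l y) (η ξ : K) :
    Tendsto (fun j => inner ℂ η (f j ξ)) l (𝓝 (inner ℂ η (y ξ))) := by
  have key : ∀ x : K →L[ℂ] K, ∑' n, inner ℂ ((lp.single 2 0 η : lp (fun _ : ℕ => K) 2) n)
      (x ((lp.single 2 0 ξ : lp (fun _ : ℕ => K) 2) n)) = inner ℂ η (x ξ) := by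
    intro x
    rw [tsum_eq_single 0]
    · simp
    · intro n hn
      simp [hn]
  simpa only [key] using ultraweakTendsto_iff.1 h (lp.single 2 0 ξ, lp.single 2 0 η)

theorem ext_of_inner {x y : K →L[ℂ] K} (h : ∀ η ξ, inner ℂ η (x ξ) = inner ℂ η (y ξ)) : x = y :=
  ContinuousLinearMap.ext fun ξ => ext_inner_left ℂ fun η => h η ξ

theorem UltraweakTendsto.unique {J : Type*} {f : J → K →L[ℂ] K} {l : Filter J} [l.NeBot]
    {y z : K →L[ℂ] K} (hy : UltraweakTendsto f l y) (hz : UltraweakTendsto f l z) : y = z :=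
  ext_of_inner fun η ξ => tendsto_nhds_unique (hy.tendsto_inner η ξ) (hz.tendsto_inner η ξ)

/-- On bounded sets, convergence in the weak operator topology implies ultra-weak convergence. -/
theorem ultraweakTendsto_of_bounded {J : Type*} {f : J → K →L[ℂ] K} {l : Filter J}
    {y : K →L[ℂ] K} {C : ℝ} (hC : ∀ j, ‖f j‖ ≤ C)
    (h : ∀ η ξ, Tendsto (fun j => inner ℂ η (f j ξ)) l (𝓝 (inner ℂ η (y ξ)))) :
    UltraweakTendsto f l y := by
  rw [ultraweakTendsto_iff]
  rintro ⟨p, q⟩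
  have hp := (memlp_two_iff _).1 (lp.memℓp p)
  have hq := (memlp_two_iff _).1 (lp.memℓp q)
  refine tendsto_tsum_of_dominated_convergence
    (bound := fun n => |C| * (‖p n‖ ^ 2 + ‖q n‖ ^ 2)) ((hp.add hq).mul_left _)
    (fun n => h _ _) (Eventually.of_forall fun j n => ?_)
  calc ‖inner ℂ (q n) (f j (p n))‖ ≤ ‖q n‖ * (|C| * ‖p n‖) :=
        (norm_inner_le_norm _ _).trans (by
          gcongr
          exact (f j).le_of_opNorm_le ((hC j).trans (le_abs_self C)) _)
    _ = |C| * (‖p n‖ * ‖q n‖) := by ring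
    _ ≤ |C| * (‖p n‖ ^ 2 + ‖q n‖ ^ 2) := by
        gcongr
        nlinarith [sq_nonneg (‖p n‖ - ‖q n‖), sq_nonneg ‖p n‖, sq_nonneg ‖q n‖]

theorem memlp_map (a : K →L[ℂ] K) (p : lp (fun _ : ℕ => K) 2) :
    Memℓp (E := fun _ : ℕ => K) (fun n => a (p n)) 2 := by
  rw [memlp_two_iff]
  refine (((memlp_two_iff _).1 (lp.memℓp p)).mul_left (‖a‖ ^ 2)).of_nonneg_of_le
    (fun _ => by positivity) fun n => ?_
  rw [← mul_pow]
  gcongr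
  exact a.le_opNorm _

theorem UltraweakTendsto.mul_right {J : Type*} {f : J → K →L[ℂ] K} {l : Filter J}
    {y : K →L[ℂ] K} (h : UltraweakTendsto f l y) (a : K →L[ℂ] K) :
    UltraweakTendsto (fun j => f j * a) l (y * a) := by
  rw [ultraweakTendsto_iff] at h ⊢
  rintro ⟨p, q⟩
  exact h (⟨_, memlp_map a p⟩, q)

theorem mem_closure_ultraweak_iff {s : Set (K →L[ℂ] K)} {x : K →L[ℂ] K} :
    x ∈ @closure _ (ultraweak K) s ↔
      ∃ l : Filter (K →L[ℂ] K), l.NeBot ∧ s ∈ l ∧ UltraweakTendsto id l x := by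
  let _ := ultraweak K
  rw [mem_closure_iff_nhdsWithin_neBot]
  constructor
  · intro h
    exact ⟨_, h, self_mem_nhdsWithin, tendsto_id.mono_left inf_le_left⟩
  · rintro ⟨l, hl, hs, h⟩
    exact hl.mono (le_inf h (le_principal_iff.2 hs))

theorem UltraweakTendsto.mem_closure {J : Type*} {f : J → K →L[ℂ] K} {l : Filter J} [l.NeBot]
    {y : K →L[ℂ] K} (h : UltraweakTendsto f l y) {s : Set (K →L[ℂ] K)}
    (hs : ∀ j, f j ∈ @closure _ (ultraweak K) s) : y ∈ @closure _ (ultraweak K) s :=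
  let _ := ultraweak K
  isClosed_closure.mem_of_tendsto h (Eventually.of_forall hs)

theorem mapsTo_closure_ultraweak {s t : Set (K →L[ℂ] K)} {F : (K →L[ℂ] K) → (K →L[ℂ] K)}
    (hF : ∀ (l : Filter (K →L[ℂ] K)) (y : K →L[ℂ] K),
      UltraweakTendsto id l y → UltraweakTendsto F l (F y))
    (h : ∀ x ∈ s, F x ∈ @closure _ (ultraweak K) t) {x : K →L[ℂ] K}
    (hx : x ∈ @closure _ (ultraweak K) s) : F x ∈ @closure _ (ultraweak K) t := by
  obtain ⟨l, hl, hs, hlx⟩ := mem_closure_ultraweak_iff.1 hx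
  let _ := ultraweak K
  exact isClosed_closure.mem_of_tendsto (hF l x hlx) (mem_of_superset hs h)

variable [CompleteSpace K]

theorem UltraweakTendsto.mul_left {J : Type*} {f : J → K →L[ℂ] K} {l : Filter J}
    {y : K →L[ℂ] K} (h : UltraweakTendsto f l y) (a : K →L[ℂ] K) :
    UltraweakTendsto (fun j => a * f j) l (a * y) := by
  rw [ultraweakTendsto_iff] at h ⊢
  rintro ⟨p, q⟩
  have := h (p, ⟨_, memlp_map (star a) q⟩)
  simpa only [ContinuousLinearMap.star_eq_adjoint,
    ContinuousLinearMap.adjoint_inner_left] using! this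

theorem UltraweakTendsto.adjoint {J : Type*} {f : J → K →L[ℂ] K} {l : Filter J}
    {y : K →L[ℂ] K} (h : UltraweakTendsto f l y) :
    UltraweakTendsto (fun j => star (f j)) l (star y) := by
  rw [ultraweakTendsto_iff] at h ⊢
  rintro ⟨p, q⟩
  have key : ∀ x : K →L[ℂ] K, ∑' n, inner ℂ (q n) ((star x) (p n)) =
      (starRingEnd ℂ) (∑' n, inner ℂ (p n) (x (q n))) := by
    intro x
    rw [Complex.conj_tsum]
    refine tsum_congr fun n => ?_
    rw [inner_conj_symm, ContinuousLinearMap.star_eq_adjoint,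
      ContinuousLinearMap.adjoint_inner_right]
  simp only [key]
  exact (Complex.continuous_conj.tendsto _).comp (h (q, p))

/-- Bounded sets of operators are relatively compact in the ultra-weak topology: along an
ultrafilter the sesquilinear forms converge, and the limit form is given by an operator. -/
theorem exists_ultraweakTendsto {J : Type*} (U : Ultrafilter J) {f : J → K →L[ℂ] K} {C : ℝ}
    (hC : ∀ j, ‖f j‖ ≤ C) : ∃ y : K →L[ℂ] K, UltraweakTendsto f U y := by
  have hlim : ∀ v w : K, ∃ z : ℂ, Tendsto (fun j => inner ℂ (f j v) w) U (𝓝 z) ∧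
      ‖z‖ ≤ C * ‖v‖ * ‖w‖ := by
    intro v w
    have hb : ∀ j, ‖inner ℂ (f j v) w‖ ≤ C * ‖v‖ * ‖w‖ := fun j =>
      (norm_inner_le_norm _ _).trans (by gcongr; exact (f j).le_of_opNorm_le (hC j) v)
    obtain ⟨z, hz, hz'⟩ := (isCompact_closedBall (0 : ℂ) (C * ‖v‖ * ‖w‖)).ultrafilter_le_nhds
      (U.map fun j => inner ℂ (f j v) w) (by
        rw [le_principal_iff]
        exact Eventually.of_forall (f := (U : Filter J)) fun j => by simpa using hb j)
    exact ⟨z, hz', by simpa using hz⟩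
  choose L hL hLC using hlim
  have add_l : ∀ v v' w, L (v + v') w = L v w + L v' w := fun v v' w =>
    tendsto_nhds_unique (hL _ _) (by
      simpa only [map_add, inner_add_left] using (hL v w).add (hL v' w))
  have smul_l : ∀ (c : ℂ) v w, L (c • v) w = (starRingEnd ℂ) c • L v w := fun c v w =>
    tendsto_nhds_unique (hL _ _) (by
      simpa only [map_smul, inner_smul_left, smul_eq_mul] using (hL v w).const_mul _)
  have add_r : ∀ v w w', L v (w + w') = L v w + L v w' := fun v w w' =>
    tendsto_nhds_unique (hL _ _) (by
      simpa only [inner_add_right] using (hL v w).add (hL v w'))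
  have smul_r : ∀ (c : ℂ) v w, L v (c • w) = (RingHom.id ℂ) c • L v w := fun c v w =>
    tendsto_nhds_unique (hL _ _) (by
      simpa only [inner_smul_right, smul_eq_mul, RingHom.id_apply] using (hL v w).const_mul _)
  let Bl : K →L⋆[ℂ] K →L[ℂ] ℂ :=
    (LinearMap.mk₂'ₛₗ (starRingEnd ℂ) (RingHom.id ℂ) L add_l smul_l add_r smul_r).mkContinuous₂ C
      hLC
  refine ⟨InnerProductSpace.continuousLinearMapOfBilin Bl, ultraweakTendsto_of_bounded hC ?_⟩
  intro η ξ
  have h1 := (Complex.continuous_conj.tendsto _).comp (hL ξ η)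
  have h2 : inner ℂ η (InnerProductSpace.continuousLinearMapOfBilin Bl ξ) =
      (starRingEnd ℂ) (L ξ η) := by
    rw [← inner_conj_symm, InnerProductSpace.continuousLinearMapOfBilin_apply]
    rfl
  rw [h2]
  simpa only [Function.comp_def, inner_conj_symm] using h1

end UltraweakTopology

/-! ### Automorphisms of von Neumann algebras have weakly closed graphs -/

section Normality

variable {H : Type*} [NormedAddCommGroup H] [InnerProductSpace ℂ H]

theorem nonneg_iff_inner {x : H →L[ℂ] H} : 0 ≤ x ↔ ∀ ξ, (0 : ℂ) ≤ inner ℂ ξ (x ξ) := by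
  rw [ContinuousLinearMap.nonneg_iff_isPositive]
  refine ⟨fun h ξ => h.inner_nonneg_right ξ, fun h => ?_⟩
  rw [ContinuousLinearMap.isPositive_iff_complex]
  intro ξ
  have h1 : inner ℂ (x ξ) ξ = inner ℂ ξ (x ξ) := by
    rw [← inner_conj_symm]
    exact Complex.conj_eq_iff_im.2 (Complex.nonneg_iff.1 (h ξ)).2.symm
  rw [h1]
  exact ⟨Complex.ext rfl (Complex.nonneg_iff.1 (h ξ)).2, (Complex.nonneg_iff.1 (h ξ)).1⟩

variable [CompleteSpace H]

theorem le_iff_inner {x y : H →L[ℂ] H} :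
    x ≤ y ↔ ∀ ξ, (inner ℂ ξ (x ξ) : ℂ) ≤ inner ℂ ξ (y ξ) := by
  rw [← sub_nonneg, nonneg_iff_inner]
  simp only [sub_apply, inner_sub_right, sub_nonneg]

theorem le_of_tendsto_inner {J : Type*} {l : Filter J} [l.NeBot] {f : J → H →L[ℂ] H}
    {y z : H →L[ℂ] H} (h : ∀ η ξ, Tendsto (fun j => inner ℂ η (f j ξ)) l (𝓝 (inner ℂ η (y ξ))))
    (hz : ∀ᶠ j in l, f j ≤ z) : y ≤ z :=
  le_iff_inner.2 fun ξ => le_of_tendsto (h ξ ξ) (hz.mono fun _ hj => le_iff_inner.1 hj ξ)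

theorem ge_of_tendsto_inner {J : Type*} {l : Filter J} [l.NeBot] {f : J → H →L[ℂ] H}
    {y z : H →L[ℂ] H} (h : ∀ η ξ, Tendsto (fun j => inner ℂ η (f j ξ)) l (𝓝 (inner ℂ η (y ξ))))
    (hz : ∀ᶠ j in l, z ≤ f j) : z ≤ y :=
  le_iff_inner.2 fun ξ => ge_of_tendsto (h ξ ξ) (hz.mono fun _ hj => le_iff_inner.1 hj ξ)

/-- A functional dominated by `x ↦ ‖T x‖`, for a linear map `T` into a Hilbert space, is of the
form `x ↦ ⟨w, T x⟩`. -/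
theorem exists_inner_of_norm_le {E : Type*} [AddCommGroup E] [Module ℂ E] (T : E →ₗ[ℂ] H)
    (f : E →ₗ[ℂ] ℂ) (C : ℝ) (h : ∀ x, ‖f x‖ ≤ C * ‖T x‖) : ∃ w : H, ∀ x, f x = inner ℂ w (T x) := by
  have hker : LinearMap.ker T ≤ LinearMap.ker f := fun x hx => by
    have h1 := h x
    rw [LinearMap.mem_ker.1 hx, norm_zero, mul_zero] at h1
    exact norm_le_zero_iff.1 h1
  let g : LinearMap.range T →ₗ[ℂ] ℂ :=
    ((LinearMap.ker T).liftQ f hker) ∘ₗ T.quotKerEquivRange.symm.toLinearMap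
  have hg : ∀ x, g ⟨T x, x, rfl⟩ = f x := by
    intro x
    have : T.quotKerEquivRange.symm ⟨T x, x, rfl⟩ = (LinearMap.ker T).mkQ x := by
      rw [LinearEquiv.symm_apply_eq]
      rfl
    simp only [g, LinearMap.comp_apply, LinearEquiv.coe_coe, this]
    rfl
  obtain ⟨G, hG, -⟩ := exists_extension_norm_eq (LinearMap.range T) (g.mkContinuous C (by
    rintro ⟨_, x, rfl⟩
    rw [hg]
    exact h x))
  refine ⟨(InnerProductSpace.toDual ℂ H).symm G, fun x => ?_⟩
  rw [InnerProductSpace.toDual_symm_apply]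
  exact (hg x).symm.trans (hG ⟨T x, x, rfl⟩).symm

variable {R : VonNeumannAlgebra H}

theorem mem_vonNeumann_of_commute {x : H →L[ℂ] H}
    (h : ∀ y, (∀ r ∈ R.toStarSubalgebra, r * y = y * r) → x * y = y * x) :
    x ∈ R.toStarSubalgebra := by
  have h1 : x ∈ R.toStarSubalgebra.carrier := by
    rw [← R.centralizer_centralizer', Set.mem_centralizer_iff]
    exact fun y hy => (h y fun r hr => Set.mem_centralizer_iff.1 hy r hr).symm
  exact h1

/-- Von Neumann algebras are closed in the weak operator topology. -/
theorem mem_vonNeumann_of_tendsto {J : Type*} {l : Filter J} [l.NeBot] {f : J → H →L[ℂ] H}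
    {x : H →L[ℂ] H} (hf : ∀ᶠ j in l, f j ∈ R.toStarSubalgebra)
    (h : ∀ η ξ, Tendsto (fun j => inner ℂ η (f j ξ)) l (𝓝 (inner ℂ η (x ξ)))) :
    x ∈ R.toStarSubalgebra := by
  refine mem_vonNeumann_of_commute fun y hy => ext_of_inner fun η ξ => ?_
  have h1 := h η (y ξ)
  have h2 := h (star y η) ξ
  simp only [ContinuousLinearMap.star_eq_adjoint, ContinuousLinearMap.adjoint_inner_left] at h2
  refine tendsto_nhds_unique h1 (h2.congr' ?_)
  filter_upwards [hf] with j hj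
  rw [← mul_apply_eq_comp, ← hy _ hj, mul_apply_eq_comp]

theorem exists_sqrt_mem {b : R.toStarSubalgebra} (hb : 0 ≤ (b : H →L[ℂ] H)) :
    ∃ h : R.toStarSubalgebra, star h = h ∧ h * h = b := by
  have hm : CFC.sqrt (b : H →L[ℂ] H) ∈ R.toStarSubalgebra :=
    mem_vonNeumann_of_commute fun y hy =>
      (Commute.cfcₙ_nnreal (show Commute (b : H →L[ℂ] H) y from hy b b.2) NNReal.sqrt).eq
  refine ⟨⟨_, hm⟩, Subtype.ext ?_, Subtype.ext ?_⟩
  · exact (CFC.sqrt_nonneg (b : H →L[ℂ] H)).isSelfAdjoint.star_eq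
  · exact CFC.sqrt_mul_sqrt_self (b : H →L[ℂ] H) hb

variable (β : R.toStarSubalgebra ≃⋆ₐ[ℂ] R.toStarSubalgebra)

theorem aut_nonneg {b : R.toStarSubalgebra} (hb : 0 ≤ (b : H →L[ℂ] H)) :
    0 ≤ (β b : H →L[ℂ] H) := by
  obtain ⟨h, hh, rfl⟩ := exists_sqrt_mem hb
  have : β (h * h) = star (β h) * β h := by rw [map_mul, ← map_star, hh]
  rw [this]
  exact star_mul_self_nonneg (β h : H →L[ℂ] H)

theorem aut_mono {a b : R.toStarSubalgebra} (hab : a ≤ b) : β a ≤ β b := by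
  have h1 : 0 ≤ ((b - a : R.toStarSubalgebra) : H →L[ℂ] H) := sub_nonneg.2 hab
  have h2 := aut_nonneg β h1
  rw [map_sub] at h2
  exact sub_nonneg.1 h2

/-- A `*`-automorphism of a von Neumann algebra preserves suprema of bounded chains, which are
also limits in the weak operator topology. -/
theorem exists_chain_limit {c : Set R.toStarSubalgebra} (hc : IsChain (· ≤ ·) c) (hne : c.Nonempty)
    {e : R.toStarSubalgebra} (hce : ∀ a ∈ c, 0 ≤ (a : H →L[ℂ] H) ∧ a ≤ e) :
    ∃ (s : R.toStarSubalgebra) (U : Ultrafilter c), (∀ a ∈ c, a ≤ s) ∧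
      (∀ η ξ, Tendsto (fun a : c => (inner ℂ η ((a.1 : H →L[ℂ] H) ξ) : ℂ)) U
        (𝓝 (inner ℂ η ((s : H →L[ℂ] H) ξ)))) ∧
      (∀ η ξ, Tendsto (fun a : c => (inner ℂ η ((β a.1 : H →L[ℂ] H) ξ) : ℂ)) U
        (𝓝 (inner ℂ η ((β s : H →L[ℂ] H) ξ)))) := by
  have : Nonempty c := hne.to_subtype
  have : IsDirectedOrder c := ⟨hc.directed⟩
  let U : Ultrafilter c := Ultrafilter.of atTop
  have hU : (U : Filter c) ≤ atTop := Ultrafilter.of_le _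
  have hb : ∀ a : c, ‖(a.1 : H →L[ℂ] H)‖ ≤ ‖(e : H →L[ℂ] H)‖ := fun a =>
    CStarAlgebra.norm_le_norm_of_nonneg_of_le (hce a a.2).1 (hce a a.2).2
  obtain ⟨s, hs⟩ := exists_ultraweakTendsto U hb
  obtain ⟨t, ht⟩ := exists_ultraweakTendsto U (f := fun a : c => (β a.1 : H →L[ℂ] H))
    fun a => (norm_aut_le β a.1).trans (hb a)
  have hsR : s ∈ R.toStarSubalgebra :=
    mem_vonNeumann_of_tendsto (Eventually.of_forall fun a : c => a.1.2) hs.tendsto_inner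
  have htR : t ∈ R.toStarSubalgebra :=
    mem_vonNeumann_of_tendsto (Eventually.of_forall fun a : c => (β a.1).2) ht.tendsto_inner
  lift s to R.toStarSubalgebra using hsR
  lift t to R.toStarSubalgebra using htR
  have hle : ∀ a ∈ c, a ≤ s := fun a ha =>
    ge_of_tendsto_inner hs.tendsto_inner ((eventually_ge_atTop (⟨a, ha⟩ : c)).filter_mono hU)
  have hle' : ∀ a ∈ c, β a ≤ t := fun a ha =>
    ge_of_tendsto_inner ht.tendsto_inner
      (((eventually_ge_atTop (⟨a, ha⟩ : c)).filter_mono hU).mono fun b hb => aut_mono β hb)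
  have h1 : t ≤ β s :=
    le_of_tendsto_inner ht.tendsto_inner (Eventually.of_forall fun a : c => aut_mono β (hle a a.2))
  have h2 : s ≤ β.symm t := by
    refine le_of_tendsto_inner hs.tendsto_inner (Eventually.of_forall fun a : c => ?_)
    have := aut_mono β.symm (hle' a a.2)
    rwa [StarAlgEquiv.symm_apply_apply] at this
  have h3 : β s ≤ t := by
    have := aut_mono β h2
    rwa [StarAlgEquiv.apply_symm_apply] at this
  obtain rfl : t = β s := le_antisymm h1 h3
  exact ⟨s, U, hle, hs.tendsto_inner, ht.tendsto_inner⟩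

/-- Below every nonzero positive `e` there is a nonzero positive `b = h²` such that
`x ↦ β(x h) ζ` is dominated by `x ↦ x h ξ` for some vector `ξ`. Take `ξ` with
`⟨ξ, e ξ⟩ > ⟨ζ, β(e) ζ⟩` and `b = e - a`, where `a` is maximal among the elements `0 ≤ a ≤ e` with
`⟨ξ, a ξ⟩ ≤ ⟨ζ, β(a) ζ⟩`: the opposite inequality then holds on the order interval `[0, b]`. -/
theorem exists_dominated (ζ : H) {e : R.toStarSubalgebra} (he : 0 ≤ (e : H →L[ℂ] H))
    (hne : e ≠ 0) : ∃ (h : R.toStarSubalgebra) (ξ : H),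
      0 ≤ ((h * h : R.toStarSubalgebra) : H →L[ℂ] H) ∧
      h * h ≤ e ∧ h * h ≠ 0 ∧
      ∀ x : R.toStarSubalgebra,
        ‖(β (x * h) : H →L[ℂ] H) ζ‖ ≤ ‖((x * h : R.toStarSubalgebra) : H →L[ℂ] H) ξ‖ := by
  obtain ⟨ξ, hξ⟩ : ∃ ξ : H, (inner ℂ ζ ((β e : H →L[ℂ] H) ζ) : ℂ) <
      inner ℂ ξ ((e : H →L[ℂ] H) ξ) := by
    obtain ⟨v, hv⟩ : ∃ v : H, (inner ℂ v ((e : H →L[ℂ] H) v) : ℂ) ≠ 0 := by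
      by_contra! hcon
      refine hne (Subtype.ext (ContinuousLinearMap.coe_injective
        ((inner_map_self_eq_zero _).1 fun v => ?_)))
      have := hcon v
      rw [← inner_conj_symm, map_eq_zero] at this
      exact this
    have hp := Complex.nonneg_iff.1 (nonneg_iff_inner.1 he v)
    have hq := Complex.nonneg_iff.1 (nonneg_iff_inner.1 (aut_nonneg β he) ζ)
    have hp' : 0 < (inner ℂ v ((e : H →L[ℂ] H) v) : ℂ).re :=
      lt_of_le_of_ne hp.1 fun h0 => hv (Complex.ext h0.symm hp.2.symm)
    obtain ⟨N, hN⟩ := exists_nat_gt ((inner ℂ ζ ((β e : H →L[ℂ] H) ζ) : ℂ).re /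
      (inner ℂ v ((e : H →L[ℂ] H) v) : ℂ).re)
    rw [div_lt_iff₀ hp'] at hN
    -- `N² ≥ N` makes the natural number `N` large enough
    refine ⟨(N : ℂ) • v, ?_⟩
    rw [map_smul, inner_smul_right, inner_smul_left, Complex.conj_natCast, ← mul_assoc,
      ← Nat.cast_mul]
    refine Complex.lt_def.2 ⟨?_, ?_⟩
    · rw [← Complex.ofReal_natCast, Complex.re_ofReal_mul]
      refine hN.trans_le ?_
      gcongr
      exact Nat.le_mul_self N
    · rw [← Complex.ofReal_natCast, Complex.im_ofReal_mul, ← hp.2, ← hq.2, mul_zero]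
  let S : Set R.toStarSubalgebra := {a | 0 ≤ (a : H →L[ℂ] H) ∧ a ≤ e ∧
    (inner ℂ ξ ((a : H →L[ℂ] H) ξ) : ℂ) ≤ inner ℂ ζ ((β a : H →L[ℂ] H) ζ)}
  have hS0 : (0 : R.toStarSubalgebra) ∈ S := ⟨le_rfl, he, by simp⟩
  obtain ⟨a, -, ha⟩ := zorn_le_nonempty₀ S (by
    intro c hcS hc y hy
    obtain ⟨s, U, h1, h2, h3⟩ := exists_chain_limit β hc ⟨y, hy⟩ (e := e)
      fun a ha => ⟨(hcS ha).1, (hcS ha).2.1⟩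
    refine ⟨s, ⟨ge_of_tendsto_inner h2 (Eventually.of_forall fun a : c => (hcS a.2).1),
      le_of_tendsto_inner h2 (Eventually.of_forall fun a : c => (hcS a.2).2.1),
      le_of_tendsto_of_tendsto (h2 ξ ξ) (h3 ζ ζ)
        (Eventually.of_forall fun a : c => (hcS a.2).2.2)⟩, h1⟩) 0 hS0
  obtain ⟨⟨ha0, hae, haψ⟩, hmax⟩ := ha
  have hb : 0 ≤ ((e - a : R.toStarSubalgebra) : H →L[ℂ] H) := sub_nonneg.2 hae
  obtain ⟨h, hh, hhb⟩ := exists_sqrt_mem hb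
  have hbound : ∀ x : R.toStarSubalgebra, ‖(x : H →L[ℂ] H)‖ ≤ 1 →
      ‖(β (x * h) : H →L[ℂ] H) ζ‖ ≤ ‖((x * h : R.toStarSubalgebra) : H →L[ℂ] H) ξ‖ := by
    intro x hx
    have hinner : ∀ (y : R.toStarSubalgebra) (v : H),
        (inner ℂ v (((star y * y : R.toStarSubalgebra) : H →L[ℂ] H) v) : ℂ) =
          ((‖(y : H →L[ℂ] H) v‖ ^ 2 : ℝ) : ℂ) := by
      intro y v
      have : ((star y * y : R.toStarSubalgebra) : H →L[ℂ] H) v =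
        ContinuousLinearMap.adjoint (y : H →L[ℂ] H) ((y : H →L[ℂ] H) v) := rfl
      rw [this, ContinuousLinearMap.adjoint_inner_right, inner_self_eq_norm_sq_to_K]
      norm_cast
    set y := x * h with hy
    have hc0 : 0 ≤ ((star y * y : R.toStarSubalgebra) : H →L[ℂ] H) :=
      star_mul_self_nonneg (y : H →L[ℂ] H)
    have hcb : star y * y ≤ e - a := by
      rw [← hhb]
      refine le_iff_inner.2 fun v => ?_
      have := hinner h v
      rw [hh] at this
      rw [hinner, this]
      norm_cast
      gcongr
      calc ‖(x : H →L[ℂ] H) ((h : H →L[ℂ] H) v)‖ ≤ 1 * ‖(h : H →L[ℂ] H) v‖ :=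
            (x : H →L[ℂ] H).le_of_opNorm_le hx _
        _ = _ := one_mul _
    -- otherwise `a + y^* y` contradicts the maximality of `a`
    by_contra hlt
    rw [not_le] at hlt
    have hψ : (inner ℂ ξ (((star y * y : R.toStarSubalgebra) : H →L[ℂ] H) ξ) : ℂ) ≤
        inner ℂ ζ ((β (star y * y) : H →L[ℂ] H) ζ) := by
      rw [map_mul, map_star, hinner, hinner]
      norm_cast
      gcongr
    have hmem : a + star y * y ∈ S := by
      refine ⟨add_nonneg ha0 hc0, ?_, ?_⟩
      · have : a + star y * y ≤ a + (e - a) := add_le_add_right (α := H →L[ℂ] H) hcb a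
        rwa [add_sub_cancel] at this
      · rw [map_add]
        simp only [AddMemClass.coe_add, add_apply, inner_add_right]
        exact add_le_add haψ hψ
    have hle : a + star y * y ≤ a := hmax hmem (le_add_of_nonneg_right (α := H →L[ℂ] H) hc0)
    have hzero : star y * y = 0 := by
      refine Subtype.ext (le_antisymm ?_ hc0)
      exact (add_le_iff_nonpos_right (α := H →L[ℂ] H) (a : H →L[ℂ] H)).1 hle
    have hy0 := hinner (β y) ζ
    rw [← map_star, ← map_mul, hzero, map_zero] at hy0
    simp only [ZeroMemClass.coe_zero, zero_apply, inner_zero_right] at hy0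
    have : ‖(β y : H →L[ℂ] H) ζ‖ = 0 := by
      exact_mod_cast pow_eq_zero_iff two_ne_zero |>.1 (Complex.ofReal_eq_zero.1 hy0.symm)
    rw [this] at hlt
    exact absurd hlt (not_lt.2 (norm_nonneg _))
  refine ⟨h, ξ, hhb ▸ hb, ?_, ?_, fun x => ?_⟩
  · rw [hhb]
    exact sub_le_self (α := H →L[ℂ] H) _ ha0
  · rw [hhb, sub_ne_zero]
    rintro rfl
    exact absurd hξ (not_lt_of_ge haψ)
  · -- rescale `x` into the unit ball
    have ht : 0 < ‖(x : H →L[ℂ] H)‖ + 1 := by positivity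
    have := hbound ((((‖(x : H →L[ℂ] H)‖ + 1)⁻¹ : ℝ) : ℂ) • x) (by
      rw [SetLike.val_smul, norm_smul, Complex.norm_real, Real.norm_of_nonneg (by positivity),
        inv_mul_le_iff₀ ht]
      linarith)
    rw [smul_mul_assoc, map_smul, SetLike.val_smul, SetLike.val_smul, smul_apply, smul_apply,
      norm_smul, norm_smul, Complex.norm_real, Real.norm_of_nonneg (by positivity)] at this
    exact le_of_mul_le_mul_left this (by positivity)

/-- If below every nonzero `e ≥ 0` in `R` there is a nonzero `b ≥ 0` with `z β(b) ζ = 0`, then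
`z ζ = 0`: a maximal `a ∈ [0, 1]` with `z β(a) ζ = 0` is the unit. -/
theorem apply_eq_zero_of_exhaustion (ζ : H) (z : H →L[ℂ] H)
    (h : ∀ e : R.toStarSubalgebra, 0 ≤ (e : H →L[ℂ] H) → e ≠ 0 →
      ∃ b : R.toStarSubalgebra, 0 ≤ (b : H →L[ℂ] H) ∧ b ≤ e ∧ b ≠ 0 ∧
        z ((β b : H →L[ℂ] H) ζ) = 0) : z ζ = 0 := by
  let S : Set R.toStarSubalgebra := {a | 0 ≤ (a : H →L[ℂ] H) ∧ a ≤ 1 ∧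
    z ((β a : H →L[ℂ] H) ζ) = 0}
  have hS0 : (0 : R.toStarSubalgebra) ∈ S :=
    ⟨le_rfl, zero_le_one (α := H →L[ℂ] H), by simp⟩
  obtain ⟨a, -, ⟨ha0, ha1, haz⟩, hmax⟩ := zorn_le_nonempty₀ S (by
    intro c hcS hc y hy
    obtain ⟨s, U, h1, h2, h3⟩ := exists_chain_limit β hc ⟨y, hy⟩ (e := 1)
      fun a ha => ⟨(hcS ha).1, (hcS ha).2.1⟩
    refine ⟨s, ⟨ge_of_tendsto_inner h2 (Eventually.of_forall fun a : c => (hcS a.2).1),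
      le_of_tendsto_inner h2 (Eventually.of_forall fun a : c => (hcS a.2).2.1), ?_⟩, h1⟩
    refine ext_inner_left ℂ fun η => ?_
    rw [inner_zero_right, ← ContinuousLinearMap.adjoint_inner_left]
    refine tendsto_nhds_unique (h3 _ ζ) (tendsto_const_nhds.congr fun a => ?_)
    rw [ContinuousLinearMap.adjoint_inner_left, (hcS a.2).2.2, inner_zero_right]) 0 hS0
  by_cases ha : a = 1
  · rw [ha, map_one] at haz
    exact haz
  · obtain ⟨b, hb0, hb1, hbne, hbz⟩ := h (1 - a) (sub_nonneg.2 ha1) (sub_ne_zero.2 (Ne.symm ha))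
    refine absurd ?_ hbne
    have hmem : a + b ∈ S := by
      refine ⟨add_nonneg ha0 hb0, ?_, ?_⟩
      · have : a + b ≤ a + (1 - a) := add_le_add_right (α := H →L[ℂ] H) hb1 a
        rwa [add_sub_cancel] at this
      · rw [map_add]
        simp only [AddMemClass.coe_add, add_apply, map_add, haz, hbz, add_zero]
    have hle : a + b ≤ a := hmax hmem (le_add_of_nonneg_right (α := H →L[ℂ] H) hb0)
    exact Subtype.ext (le_antisymm
      ((add_le_iff_nonpos_right (α := H →L[ℂ] H) (a : H →L[ℂ] H)).1 hle) hb0)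

/-- A `*`-automorphism of a von Neumann algebra has a closed graph for the weak operator
topology: the functionals `x ↦ ⟨η, β(x h²) ζ⟩`, with `h` as in `exists_dominated`, are continuous
and separate points. -/
theorem aut_apply_of_tendsto {J : Type*} {l : Filter J} [l.NeBot] {f : J → R.toStarSubalgebra}
    {a : R.toStarSubalgebra} {b : H →L[ℂ] H}
    (ha : ∀ η ξ, Tendsto (fun j => (inner ℂ η ((f j : H →L[ℂ] H) ξ) : ℂ)) l
      (𝓝 (inner ℂ η ((a : H →L[ℂ] H) ξ))))
    (hb : ∀ η ξ, Tendsto (fun j => (inner ℂ η ((β (f j) : H →L[ℂ] H) ξ) : ℂ)) l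
      (𝓝 (inner ℂ η (b ξ)))) : (β a : H →L[ℂ] H) = b := by
  rw [← sub_eq_zero]
  refine ContinuousLinearMap.ext fun ζ => ?_
  refine apply_eq_zero_of_exhaustion β ζ _ fun e he hne => ?_
  obtain ⟨h, ξ, h0, hle, hh, hdom⟩ := exists_dominated β ζ he hne
  refine ⟨h * h, h0, hle, hh, ?_⟩
  rw [sub_apply, sub_eq_zero]
  refine ext_inner_left ℂ fun η => ?_
  let T : R.toStarSubalgebra →ₗ[ℂ] H :=
    { toFun := fun x => ((x * h : R.toStarSubalgebra) : H →L[ℂ] H) ξ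
      map_add' := fun x y => by simp [add_mul]
      map_smul' := fun c x => by simp }
  let g : R.toStarSubalgebra →ₗ[ℂ] ℂ :=
    { toFun := fun x => inner ℂ η ((β (x * h) : H →L[ℂ] H) ζ)
      map_add' := fun x y => by simp [add_mul]
      map_smul' := fun c x => by simp }
  obtain ⟨w, hw⟩ := exists_inner_of_norm_le T g ‖η‖ fun x =>
    (norm_inner_le_norm _ _).trans (mul_le_mul_of_nonneg_left (hdom x) (norm_nonneg _))
  -- `x ↦ ⟨η, β(x) β(h²) ζ⟩` is a vector functional of `x`
  have hw' : ∀ x : R.toStarSubalgebra, (inner ℂ η ((β x : H →L[ℂ] H)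
      ((β (h * h) : H →L[ℂ] H) ζ)) : ℂ) =
      inner ℂ w ((x : H →L[ℂ] H) (((h * h : R.toStarSubalgebra) : H →L[ℂ] H) ξ)) := by
    intro x
    have := hw (x * h)
    simpa [T, g, mul_assoc] using this
  rw [hw']
  refine tendsto_nhds_unique (ha _ _) ((hb _ _).congr fun j => ?_)
  rw [hw']

end Normality

/-! ### Matrix entries and the algebra structure of the crossed product -/

section Entries

variable {H : Type*} [NormedAddCommGroup H] [InnerProductSpace ℂ H] {G : Type*}

open Classical in
theorem entry_apply (x : L2 H G →L[ℂ] L2 H G) (s t : G) (η : H) :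
    entry x s t η = x (lp.single 2 t η) s := rfl

open Classical in
theorem inner_entry (x : L2 H G →L[ℂ] L2 H G) (s t : G) (η ξ : H) :
    inner ℂ η (entry x s t ξ) = inner ℂ (lp.single 2 s η : L2 H G) (x (lp.single 2 t ξ)) := by
  rw [lp.inner_single_left, entry_apply]

theorem ext_entry {x y : L2 H G →L[ℂ] L2 H G} (h : ∀ s t, entry x s t = entry y s t) : x = y := by
  classical
  refine ContinuousLinearMap.ext fun f => ?_
  have hf := lp.hasSum_single (p := 2) (by norm_num) f
  refine (hf.mapL x).unique ?_
  convert hf.mapL y using 2 with t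
  ext s
  exact congrArg (fun T : H →L[ℂ] H => T (f t)) (h s t)

theorem entry_add (x y : L2 H G →L[ℂ] L2 H G) (s t : G) :
    entry (x + y) s t = entry x s t + entry y s t := rfl

theorem entry_sub (x y : L2 H G →L[ℂ] L2 H G) (s t : G) :
    entry (x - y) s t = entry x s t - entry y s t := rfl

theorem entry_smul (c : ℂ) (x : L2 H G →L[ℂ] L2 H G) (s t : G) :
    entry (c • x) s t = c • entry x s t := rfl

theorem entry_zero (s t : G) : entry (0 : L2 H G →L[ℂ] L2 H G) s t = 0 := rfl

theorem entry_sum {ι : Type*} (F : Finset ι) (x : ι → L2 H G →L[ℂ] L2 H G) (s t : G) :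
    entry (∑ i ∈ F, x i) s t = ∑ i ∈ F, entry (x i) s t :=
  map_sum (AddMonoidHom.mk' (fun x : L2 H G →L[ℂ] L2 H G => entry x s t) fun x y =>
    entry_add x y s t) x F

open Classical in
theorem entry_one (s t : G) :
    entry (1 : L2 H G →L[ℂ] L2 H G) s t = if s = t then 1 else 0 := by
  ext η
  rw [entry_apply, one_apply_eq_self]
  split_ifs with h
  · subst h; simp
  · simp [h]

theorem diagonalOp_apply (a : G → H →L[ℂ] H) (C : ℝ) (ha : ∀ g, ‖a g‖ ≤ C) (f : L2 H G) (g : G) :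
    diagonalOp a C ha f g = a g (f g) := rfl

theorem entry_diagonalOp_mul (a : G → H →L[ℂ] H) (C : ℝ) (ha : ∀ g, ‖a g‖ ≤ C)
    (x : L2 H G →L[ℂ] L2 H G) (s t : G) :
    entry (diagonalOp a C ha * x) s t = a s * entry x s t := rfl

open Classical in
theorem diagonalOp_single (a : G → H →L[ℂ] H) (C : ℝ) (ha : ∀ g, ‖a g‖ ≤ C) (t : G) (η : H) :
    diagonalOp a C ha (lp.single 2 t η) = lp.single 2 t (a t η) := by
  ext s
  rw [diagonalOp_apply]
  by_cases h : s = t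
  · subst h; simp
  · simp [h]

theorem entry_mul_diagonalOp (a : G → H →L[ℂ] H) (C : ℝ) (ha : ∀ g, ‖a g‖ ≤ C)
    (x : L2 H G →L[ℂ] L2 H G) (s t : G) :
    entry (x * diagonalOp a C ha) s t = entry x s t * a t := by
  ext η
  rw [entry_apply, mul_apply_eq_comp, diagonalOp_single]
  rfl

theorem entry_diagonalOp_of_ne (a : G → H →L[ℂ] H) (C : ℝ) (ha : ∀ g, ‖a g‖ ≤ C) {s t : G}
    (h : s ≠ t) : entry (diagonalOp a C ha) s t = 0 := by
  classical
  rw [← mul_one (diagonalOp a C ha), entry_diagonalOp_mul, entry_one, if_neg h, mul_zero]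

theorem entry_diagonalOp_self (a : G → H →L[ℂ] H) (C : ℝ) (ha : ∀ g, ‖a g‖ ≤ C) (t : G) :
    entry (diagonalOp a C ha) t t = a t := by
  classical
  rw [← mul_one (diagonalOp a C ha), entry_diagonalOp_mul, entry_one, if_pos rfl, mul_one]

theorem UltraweakTendsto.tendsto_inner_entry {J : Type*} {l : Filter J}
    {f : J → L2 H G →L[ℂ] L2 H G} {y : L2 H G →L[ℂ] L2 H G} (h : UltraweakTendsto f l y) (s t : G)
    (η ξ : H) :
    Tendsto (fun j => inner ℂ η (entry (f j) s t ξ)) l (𝓝 (inner ℂ η (entry y s t ξ))) := by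
  classical
  simpa only [inner_entry] using h.tendsto_inner _ _

variable [Group G]

theorem leftOp_apply (g : G) (f : L2 H G) (h : G) : leftOp g f h = f (g⁻¹ * h) := rfl

theorem leftOp_mul (g h : G) : (leftOp (g * h) : L2 H G →L[ℂ] L2 H G) = leftOp g * leftOp h := by
  ext f s
  simp only [mul_apply_eq_comp, leftOp_apply, mul_inv_rev, mul_assoc]

theorem leftOp_one : (leftOp (1 : G) : L2 H G →L[ℂ] L2 H G) = 1 := by
  ext f s
  simp [leftOp_apply]

theorem entry_leftOp_mul (g : G) (x : L2 H G →L[ℂ] L2 H G) (s t : G) :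
    entry (leftOp g * x) s t = entry x (g⁻¹ * s) t := rfl

variable [CompleteSpace H]

theorem entry_star {G : Type*} (x : L2 H G →L[ℂ] L2 H G) (s t : G) :
    entry (star x) s t = star (entry x t s) := by
  classical
  refine ext_of_inner fun η ξ => ?_
  rw [inner_entry, ContinuousLinearMap.star_eq_adjoint, ContinuousLinearMap.adjoint_inner_right,
    ContinuousLinearMap.star_eq_adjoint, ContinuousLinearMap.adjoint_inner_right,
    ← inner_conj_symm, ← inner_entry, inner_conj_symm]

theorem star_leftOp (g : G) : star (leftOp g : L2 H G →L[ℂ] L2 H G) = leftOp g⁻¹ := by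
  classical
  refine ext_entry fun s t => ?_
  rw [entry_star, ← mul_one (leftOp g), ← mul_one (leftOp g⁻¹), entry_leftOp_mul, entry_leftOp_mul,
    entry_one, entry_one, inv_inv]
  by_cases h : g * s = t
  · rw [if_pos h, if_pos (by rw [← h, inv_mul_cancel_left]), star_one]
  · rw [if_neg h, if_neg (fun h' => h (by rw [← h', mul_inv_cancel_left])), star_zero]

end Entries

section CrossedProductAlgebra

variable {H : Type*} [NormedAddCommGroup H] [InnerProductSpace ℂ H] [CompleteSpace H]
  {R : VonNeumannAlgebra H} {G : Type*} [Group G]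
  (α : G →* (R.toStarSubalgebra ≃⋆ₐ[ℂ] R.toStarSubalgebra))

theorem Psi_apply (r : R.toStarSubalgebra) (f : L2 H G) (g : G) :
    Psi α r f g = (α g⁻¹ r : H →L[ℂ] H) (f g) := rfl

theorem aut_mul_apply (g h : G) (r : R.toStarSubalgebra) : α g (α h r) = α (g * h) r := by
  rw [map_mul]; rfl

theorem aut_one_apply (r : R.toStarSubalgebra) : α 1 r = r := by
  rw [map_one]; rfl

/-- `Ψ` as a homomorphism of `*`-algebras. -/
noncomputable def PsiHom : R.toStarSubalgebra →⋆ₐ[ℂ] (L2 H G →L[ℂ] L2 H G) where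
  toFun := Psi α
  map_one' := by ext f g; simp [Psi_apply]
  map_mul' r r' := by ext f g; simp [Psi_apply]
  map_zero' := by ext f g; simp [Psi_apply]
  map_add' r r' := by ext f g; simp [Psi_apply]
  commutes' c := by
    ext f g
    rw [Psi_apply, AlgHomClass.commutes (α g⁻¹)]
    rfl
  map_star' r := by
    refine ext_entry fun s t => ?_
    rw [entry_star]
    by_cases h : s = t
    · subst h
      unfold Psi
      rw [entry_diagonalOp_self, entry_diagonalOp_self, map_star]
      rfl
    · unfold Psi
      rw [entry_diagonalOp_of_ne _ _ _ h, entry_diagonalOp_of_ne _ _ _ (Ne.symm h), star_zero]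

theorem PsiHom_apply (r : R.toStarSubalgebra) : PsiHom α r = Psi α r := rfl

theorem Psi_mul (r r' : R.toStarSubalgebra) : Psi α (r * r') = Psi α r * Psi α r' :=
  map_mul (PsiHom α) r r'

theorem Psi_one : Psi α (1 : R.toStarSubalgebra) = 1 := map_one (PsiHom α)

theorem Psi_star (r : R.toStarSubalgebra) : Psi α (star r) = star (Psi α r) :=
  map_star (PsiHom α) r

theorem Psi_add (r r' : R.toStarSubalgebra) : Psi α (r + r') = Psi α r + Psi α r' :=
  map_add (PsiHom α) r r'

theorem Psi_smul (c : ℂ) (r : R.toStarSubalgebra) : Psi α (c • r) = c • Psi α r :=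
  map_smul (PsiHom α) c r

/-- The covariance relation `L_g Ψ(r) L_g^* = Ψ(α_g(r))`. -/
theorem Psi_mul_leftOp (g : G) (r : R.toStarSubalgebra) :
    Psi α (α g r) * leftOp g = leftOp g * Psi α r := by
  ext f s
  simp only [mul_apply_eq_comp, leftOp_apply, Psi_apply, aut_mul_apply, mul_inv_rev, inv_inv]

theorem entry_Psi_mul (r : R.toStarSubalgebra) (x : L2 H G →L[ℂ] L2 H G) (s t : G) :
    entry (Psi α r * x) s t = (α s⁻¹ r : H →L[ℂ] H) * entry x s t := rfl

theorem entry_mul_Psi (r : R.toStarSubalgebra) (x : L2 H G →L[ℂ] L2 H G) (s t : G) :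
    entry (x * Psi α r) s t = entry x s t * (α t⁻¹ r : H →L[ℂ] H) :=
  entry_mul_diagonalOp _ _ _ x s t

open Classical in
theorem entry_leftOp_mul_Psi (g : G) (r : R.toStarSubalgebra) (s t : G) :
    entry (leftOp g * Psi α r) s t = if s * t⁻¹ = g then (α t⁻¹ r : H →L[ℂ] H) else 0 := by
  rw [entry_mul_Psi, ← mul_one (leftOp g), entry_leftOp_mul, entry_one]
  by_cases h : s * t⁻¹ = g
  · rw [if_pos h, if_pos (by rw [← h]; group), one_mul]
  · rw [if_neg h, if_neg (fun h' => h (by rw [← h']; group)), zero_mul]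

theorem leftOp_mul_Psi_mem (g : G) (r : R.toStarSubalgebra) :
    leftOp g * Psi α r ∈ crossedSpan α := Submodule.subset_span ⟨g, r, rfl⟩

theorem crossedSpan_subset_crossedProduct {x : L2 H G →L[ℂ] L2 H G} (hx : x ∈ crossedSpan α) :
    x ∈ crossedProduct α := by
  let _ := ultraweak (L2 H G)
  exact subset_closure hx

theorem mul_mem_crossedSpan {x y : L2 H G →L[ℂ] L2 H G} (hx : x ∈ crossedSpan α)
    (hy : y ∈ crossedSpan α) : x * y ∈ crossedSpan α := by
  unfold crossedSpan at hx
  induction hx using Submodule.span_induction with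
  | mem x hx =>
    obtain ⟨g, r, rfl⟩ := hx
    unfold crossedSpan at hy
    induction hy using Submodule.span_induction with
    | mem y hy =>
      obtain ⟨h, r', rfl⟩ := hy
      have h1 := Psi_mul_leftOp α h (α h⁻¹ r)
      rw [aut_mul_apply, mul_inv_cancel, aut_one_apply] at h1
      have : leftOp g * Psi α r * (leftOp h * Psi α r') =
          leftOp (g * h) * Psi α (α h⁻¹ r * r') := by
        rw [mul_assoc, ← mul_assoc (Psi α r), h1, leftOp_mul, Psi_mul]
        simp only [mul_assoc]
      rw [this]
      exact leftOp_mul_Psi_mem α _ _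
    | zero => rw [mul_zero]; exact zero_mem _
    | add y z _ _ hy hz => rw [mul_add]; exact add_mem hy hz
    | smul c y _ hy => rw [mul_smul_comm]; exact Submodule.smul_mem _ _ hy
  | zero => rw [zero_mul]; exact zero_mem _
  | add x z _ _ hx hz => rw [add_mul]; exact add_mem hx hz
  | smul c x _ hx => rw [smul_mul_assoc]; exact Submodule.smul_mem _ _ hx

theorem star_mem_crossedSpan {x : L2 H G →L[ℂ] L2 H G} (hx : x ∈ crossedSpan α) :
    star x ∈ crossedSpan α := by
  unfold crossedSpan at hx
  induction hx using Submodule.span_induction with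
  | mem x hx =>
    obtain ⟨g, r, rfl⟩ := hx
    have h1 := Psi_mul_leftOp α g⁻¹ (α g (star r))
    rw [aut_mul_apply, inv_mul_cancel, aut_one_apply] at h1
    rw [star_mul, star_leftOp, ← Psi_star, h1]
    exact leftOp_mul_Psi_mem α _ _
  | zero => rw [star_zero]; exact zero_mem _
  | add x z _ _ hx hz => rw [star_add]; exact add_mem hx hz
  | smul c x _ hx => rw [star_smul]; exact Submodule.smul_mem _ _ hx

theorem mul_mem_crossedProduct {x y : L2 H G →L[ℂ] L2 H G} (hx : x ∈ crossedProduct α)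
    (hy : y ∈ crossedProduct α) : x * y ∈ crossedProduct α :=
  mapsTo_closure_ultraweak (F := fun z => z * y) (fun _ _ h => h.mul_right y)
    (fun z hz => mapsTo_closure_ultraweak (F := fun w => z * w) (fun _ _ h => h.mul_left z)
      (fun _ hw => crossedSpan_subset_crossedProduct α (mul_mem_crossedSpan α hz hw)) hy) hx

theorem star_mem_crossedProduct {x : L2 H G →L[ℂ] L2 H G} (hx : x ∈ crossedProduct α) :
    star x ∈ crossedProduct α :=
  mapsTo_closure_ultraweak (F := star) (fun _ _ h => h.adjoint)
    (fun _ hw => crossedSpan_subset_crossedProduct α (star_mem_crossedSpan α hw)) hx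

/-- The matrix entries of an element of the crossed product satisfy
`x_{(s,t)} = α_{t⁻¹}(c_{s t⁻¹})` for a family `(c_g)` in `R`. For the span this is a computation;
it passes to the ultra-weak closure because automorphisms of `R` have closed graphs. -/
theorem exists_covariant_entries {x : L2 H G →L[ℂ] L2 H G} (hx : x ∈ crossedProduct α) :
    ∃ c : G → R.toStarSubalgebra, ∀ s t, entry x s t = (α t⁻¹ (c (s * t⁻¹)) : H →L[ℂ] H) := by
  classical
  have hspan : ∀ y ∈ crossedSpan α,
      ∃ c : G → R.toStarSubalgebra, ∀ s t, entry y s t = (α t⁻¹ (c (s * t⁻¹)) : H →L[ℂ] H) := by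
    intro y hy
    unfold crossedSpan at hy
    induction hy using Submodule.span_induction with
    | mem y hy =>
      obtain ⟨g, r, rfl⟩ := hy
      refine ⟨fun h => if h = g then r else 0, fun s t => ?_⟩
      rw [entry_leftOp_mul_Psi]
      by_cases h : s * t⁻¹ = g
      · simp only [h, if_true]
      · simp only [h, if_false, map_zero, ZeroMemClass.coe_zero]
    | zero => exact ⟨0, fun s t => by simp [entry_zero]⟩
    | add y z _ _ hy hz =>
      obtain ⟨c, hc⟩ := hy
      obtain ⟨d, hd⟩ := hz
      exact ⟨c + d, fun s t => by rw [entry_add, hc, hd]; simp⟩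
    | smul k y _ hy =>
      obtain ⟨c, hc⟩ := hy
      exact ⟨k • c, fun s t => by rw [entry_smul, hc]; simp⟩
  obtain ⟨l, hl, hs, h⟩ := mem_closure_ultraweak_iff.1 hx
  choose! c hc using hspan
  have hc1 : ∀ y ∈ crossedSpan α, ∀ g, (c y g : H →L[ℂ] H) = entry y g 1 := fun y hy g => by
    rw [hc y hy, inv_one, mul_one, aut_one_apply]
  have hmem : ∀ g, entry x g 1 ∈ R.toStarSubalgebra := fun g =>
    mem_vonNeumann_of_tendsto (f := fun y => entry y g 1)
      (mem_of_superset hs fun y hy => by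
        change entry y g 1 ∈ R.toStarSubalgebra
        rw [← hc1 y hy]
        exact (c y g).2) (h.tendsto_inner_entry g 1)
  refine ⟨fun g => ⟨entry x g 1, hmem g⟩, fun s t => ?_⟩
  refine (aut_apply_of_tendsto (α t⁻¹) (l := l) (f := fun y => c y (s * t⁻¹)) ?_ ?_).symm
  · intro η ξ
    refine (h.tendsto_inner_entry (s * t⁻¹) 1 η ξ).congr' ?_
    filter_upwards [hs] with y hy
    rw [hc1 y hy]; rfl
  · intro η ξ
    refine (h.tendsto_inner_entry s t η ξ).congr' ?_
    filter_upwards [hs] with y hy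
    rw [← hc y hy]; rfl

end CrossedProductAlgebra

/-! ### The maps `σ_ξ` -/

section AmplifiedHom

/-- A positive element of a C⋆-algebra is of the form `b^* b`, where `b` commutes with everything
that commutes with it. -/
theorem exists_eq_star_mul_self_commute {A : Type*} [NonUnitalCStarAlgebra A] [PartialOrder A]
    [StarOrderedRing A] {a : A} (ha : 0 ≤ a) :
    ∃ b, a = star b * b ∧ ∀ d, Commute a d → Commute b d := by
  refine ⟨CFC.sqrt a, ?_, fun d hd => hd.cfcₙ_nnreal _⟩
  rw [(CFC.sqrt_nonneg a).isSelfAdjoint.star_eq, CFC.sqrt_mul_sqrt_self a]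

variable {H : Type*} [NormedAddCommGroup H] [InnerProductSpace ℂ H] [CompleteSpace H]
  {K : Type*} [NormedAddCommGroup K] [InnerProductSpace ℂ K] [CompleteSpace K]
  {R : VonNeumannAlgebra H}

/-- `*`-homomorphisms of a von Neumann algebra are completely positive. The square root of a
positive matrix with entries in `R` commutes with the diagonal matrices of elements of the
commutant, hence has entries in `R`. -/
theorem hom_form_nonneg (ρ : R.toStarSubalgebra →⋆ₐ[ℂ] (K →L[ℂ] K)) {n : Type*} [Fintype n]
    (P : n → n → R.toStarSubalgebra)
    (hP : (0 : CStarMatrix n n (H →L[ℂ] H)) ≤ CStarMatrix.ofMatrix fun i j => (P i j : H →L[ℂ] H))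
    (ξ : n → K) : 0 ≤ ∑ i, ∑ j, inner ℂ (ξ i) (ρ (P i j) (ξ j)) := by
  classical
  obtain ⟨N, hN, hcomm⟩ := exists_eq_star_mul_self_commute hP
  have hNR : ∀ i j, N i j ∈ R.toStarSubalgebra := by
    intro i j
    refine mem_vonNeumann_of_commute fun y hy => ?_
    let D : CStarMatrix n n (H →L[ℂ] H) := CStarMatrix.ofMatrix (Matrix.diagonal fun _ => y)
    have hr : ∀ (M : CStarMatrix n n (H →L[ℂ] H)) i j, (M * D) i j = M i j * y :=
      fun M i j => Matrix.mul_diagonal (fun _ => y) M i j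
    have hl : ∀ (M : CStarMatrix n n (H →L[ℂ] H)) i j, (D * M) i j = y * M i j :=
      fun M i j => Matrix.diagonal_mul (fun _ => y) M i j
    have := hcomm D (CStarMatrix.ext fun i j => by
      rw [hr, hl]
      exact hy _ (P i j).2)
    rw [← hr, ← hl, this.eq]
  let Q : n → n → R.toStarSubalgebra := fun i j => ⟨N i j, hNR i j⟩
  have hPQ : ∀ i j, P i j = ∑ k, star (Q k i) * Q k j := by
    intro i j
    refine Subtype.ext ?_
    have := congrArg (fun M : CStarMatrix n n (H →L[ℂ] H) => M i j) hN
    simp only [CStarMatrix.mul_apply, CStarMatrix.star_apply] at this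
    refine this.trans ?_
    rw [AddSubmonoidClass.coe_finsetSum]
    rfl
  have key : ∑ i, ∑ j, inner ℂ (ξ i) (ρ (P i j) (ξ j)) =
      ∑ k, inner ℂ (∑ i, ρ (Q k i) (ξ i)) (∑ j, ρ (Q k j) (ξ j)) := by
    simp only [hPQ, map_sum, map_mul, map_star, sum_apply, mul_apply_eq_comp, inner_sum, sum_inner]
    simp only [ContinuousLinearMap.star_eq_adjoint, ContinuousLinearMap.adjoint_inner_right]
    rw [Finset.sum_congr rfl fun i _ => Finset.sum_comm, Finset.sum_comm]
    exact Finset.sum_congr rfl fun k _ => Finset.sum_comm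
  rw [key]
  exact Finset.sum_nonneg fun k _ => inner_self_nonneg_complex _

end AmplifiedHom

section Projection

variable {H : Type*} [NormedAddCommGroup H] [InnerProductSpace ℂ H] [CompleteSpace H]
  {R : VonNeumannAlgebra H} (π : CPProjection R)

theorem CPProjection.proj_coe (r : R.toStarSubalgebra) : π.proj r = r :=
  Subtype.ext (π.map_of_mem' r r.2)

theorem CPProjection.proj_one : π.proj 1 = 1 := π.proj_coe 1

theorem CPProjection.proj_zero : π.proj 0 = 0 := π.proj_coe 0

theorem CPProjection.proj_add (x y : H →L[ℂ] H) : π.proj (x + y) = π.proj x + π.proj y :=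
  Subtype.ext (map_add π.toCP x y)

theorem CPProjection.proj_smul (c : ℂ) (x : H →L[ℂ] H) : π.proj (c • x) = c • π.proj x :=
  Subtype.ext (map_smul π.toCP c x)

theorem CPProjection.proj_coe_mul (r : R.toStarSubalgebra) (x : H →L[ℂ] H) :
    π.proj (r * x) = r * π.proj x := by
  refine Subtype.ext ?_
  have hr : π.toCP r = r := π.map_of_mem' r r.2
  refine (cp_map_mul_of_map_mul_star_self π.toCP (π.map_of_mem' 1 (one_mem _)) ?_ x).trans ?_
  · rw [hr]
    exact π.map_of_mem' _ (mul_mem r.2 (star_mem r.2))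
  · rw [hr]; rfl

theorem CPProjection.proj_mul_coe (r : R.toStarSubalgebra) (x : H →L[ℂ] H) :
    π.proj (x * r) = π.proj x * r := by
  refine Subtype.ext ?_
  have hr : π.toCP r = r := π.map_of_mem' r r.2
  refine (cp_map_mul_of_map_star_mul_self π.toCP (π.map_of_mem' 1 (one_mem _)) ?_ x).trans ?_
  · rw [hr]
    exact π.map_of_mem' _ (mul_mem (star_mem r.2) r.2)
  · rw [hr]; rfl

end Projection

section CharacteristicVector

variable {G : Type*}

theorem xi_support {S : Finset G} (hS : S.Nonempty) : (xi S).support = S := by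
  classical
  have hc : (0 : ℝ) < S.card := by exact_mod_cast hS.card_pos
  ext g
  rw [Finsupp.mem_support_iff, xi, Finsupp.indicator_apply]
  by_cases hg : g ∈ S
  · simp [hg, hS.ne_empty]
  · simp [hg]

theorem xi_apply {S : Finset G} {g : G} (hg : g ∈ S) :
    xi S g = ((Real.sqrt (S.card : ℝ))⁻¹ : ℂ) := by
  rw [xi, Finsupp.indicator_of_mem hg]

theorem xi_norm {S : Finset G} (hS : S.Nonempty) : ∑ g ∈ (xi S).support, ‖xi S g‖ ^ 2 = 1 := by
  have hc : (0 : ℝ) < S.card := by exact_mod_cast hS.card_pos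
  rw [xi_support hS, Finset.sum_congr rfl fun g hg => by rw [xi_apply hg], Finset.sum_const,
    norm_inv, Complex.norm_real, Real.norm_of_nonneg (Real.sqrt_nonneg _), inv_pow,
    Real.sq_sqrt hc.le, nsmul_eq_mul, mul_inv_cancel₀ hc.ne']

end CharacteristicVector

section SigmaMap

variable {H : Type*} [NormedAddCommGroup H] [InnerProductSpace ℂ H] [CompleteSpace H]
  {R : VonNeumannAlgebra H} {G : Type*} [Group G]
  (α : G →* (R.toStarSubalgebra ≃⋆ₐ[ℂ] R.toStarSubalgebra)) (π : CPProjection R) (ξ : G →₀ ℂ)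

/-- `σ_ξ` as a linear map. -/
noncomputable def sigmaLin : (L2 H G →L[ℂ] L2 H G) →ₗ[ℂ] (L2 H G →L[ℂ] L2 H G) where
  toFun := sigmaMap α π ξ
  map_add' x y := by
    simp only [sigmaMap, entry_add, π.proj_add, map_add, Psi_add, mul_add, smul_add,
      Finset.sum_add_distrib]
  map_smul' c x := by
    simp only [sigmaMap, entry_smul, π.proj_smul, map_smul, Psi_smul, mul_smul_comm,
      smul_comm _ c, ← Finset.smul_sum, RingHom.id_apply]

/-- `L_{gh⁻¹} Ψ(α_h(r)) = L_g Ψ(r) L_h^*`. -/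
theorem leftOp_mul_Psi_aut (g h : G) (r : R.toStarSubalgebra) :
    leftOp (g * h⁻¹) * Psi α (α h r) =
      leftOp g * Psi α r * star (leftOp h : L2 H G →L[ℂ] L2 H G) := by
  have h1 : Psi α r * leftOp h⁻¹ = leftOp h⁻¹ * Psi α (α h r) := by
    rw [← Psi_mul_leftOp, aut_mul_apply, inv_mul_cancel, aut_one_apply]
  rw [star_leftOp, mul_assoc, h1, leftOp_mul, mul_assoc]

theorem sigmaMap_form_nonneg (k : ℕ) (M : CStarMatrix (Fin k) (Fin k) (L2 H G →L[ℂ] L2 H G))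
    (hM : 0 ≤ M) (f : Fin k → L2 H G) :
    0 ≤ ∑ i, ∑ j, inner ℂ (f i) (sigmaLin α π ξ (M i j) (f j)) := by
  classical
  let n := Fin k × ξ.support
  -- the matrix of all matrix entries of the `M i j` with indices in the support of `ξ`
  let E : CStarMatrix n n (H →L[ℂ] H) :=
    CStarMatrix.ofMatrix fun p q => entry (M p.1 q.1) p.2 q.2
  have hE : 0 ≤ E := by
    refine CStarMatrix.nonneg_of_sum_inner_nonneg fun η => ?_
    have h1 := CStarMatrix.sum_inner_nonneg hM
      fun i => ∑ g : ξ.support, (lp.single 2 (g : G) (η (i, g)) : L2 H G)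
    simp only [map_sum, inner_sum, sum_inner, ← inner_entry] at h1
    have h2 : ∑ p : n, ∑ q : n, inner ℂ (η p) (E p q (η q)) = ∑ i, ∑ j, ∑ h : ξ.support,
        ∑ g : ξ.support, inner ℂ (η (i, g)) (entry (M i j) g h (η (j, h))) := by
      simp only [n, Fintype.sum_prod_type]
      refine Finset.sum_congr rfl fun i _ => ?_
      rw [Finset.sum_comm]
      exact Finset.sum_congr rfl fun j _ => Finset.sum_comm
    exact h1.trans_eq h2.symm
  have hP := π.toCP.map_cstarMatrix_nonneg E hE
  have hform := hom_form_nonneg (PsiHom α) (fun p q : n => π.proj (entry (M p.1 q.1) p.2 q.2)) hP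
    (fun p => ξ p.2 • star (leftOp (p.2 : G) : L2 H G →L[ℂ] L2 H G) (f p.1))
  refine hform.trans_eq ?_
  simp only [n, Fintype.sum_prod_type]
  refine Finset.sum_congr rfl fun i _ => ?_
  rw [Finset.sum_comm]
  refine Finset.sum_congr rfl fun j _ => ?_
  have h3 : sigmaLin α π ξ (M i j) (f j) = ∑ g : ξ.support, ∑ h : ξ.support,
      ((starRingEnd ℂ) (ξ g) * ξ h) • (leftOp (g : G) (Psi α (π.proj (entry (M i j) g h))
        (star (leftOp (h : G) : L2 H G →L[ℂ] L2 H G) (f j)))) := by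
    change sigmaMap α π ξ (M i j) (f j) = _
    simp only [sigmaMap, leftOp_mul_Psi_aut, sum_apply, smul_apply, mul_apply_eq_comp]
    rw [← Finset.sum_coe_sort]
    exact Finset.sum_congr rfl fun g _ => (Finset.sum_coe_sort _ _).symm
  rw [h3, inner_sum]
  refine Finset.sum_congr rfl fun g _ => ?_
  rw [inner_sum]
  refine Finset.sum_congr rfl fun h _ => ?_
  rw [PsiHom_apply, map_smul, inner_smul_right, inner_smul_right, inner_smul_left]
  have hadj : ∀ v w : L2 H G, (inner ℂ (star (leftOp (g : G) : L2 H G →L[ℂ] L2 H G) v) w : ℂ) =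
      inner ℂ v (leftOp (g : G) w) := fun v w => ContinuousLinearMap.adjoint_inner_left _ _ _
  rw [hadj]
  ring

/-- `σ_ξ` as a completely positive map. -/
noncomputable def sigmaCP : (L2 H G →L[ℂ] L2 H G) →CP (L2 H G →L[ℂ] L2 H G) :=
  cpOfForm (sigmaLin α π ξ) (sigmaMap_form_nonneg α π ξ)

theorem sigmaCP_apply (x : L2 H G →L[ℂ] L2 H G) : sigmaCP α π ξ x = sigmaMap α π ξ x := rfl

theorem sigmaMap_one (hξ : ∑ g ∈ ξ.support, ‖ξ g‖ ^ 2 = 1) : sigmaMap α π ξ 1 = 1 := by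
  classical
  have h1 : ∀ g ∈ ξ.support, ∑ h ∈ ξ.support, ((starRingEnd ℂ) (ξ g) * ξ h) •
      (leftOp (g * h⁻¹) * Psi α (α h (π.proj (entry (1 : L2 H G →L[ℂ] L2 H G) g h)))) =
      ((‖ξ g‖ ^ 2 : ℝ) : ℂ) • (1 : L2 H G →L[ℂ] L2 H G) := by
    intro g hg
    rw [Finset.sum_eq_single_of_mem g hg]
    · rw [entry_one, if_pos rfl, π.proj_one, map_one, Psi_one, mul_inv_cancel, leftOp_one, mul_one,
        Complex.conj_mul']
      norm_cast
    · intro h _ hne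
      rw [entry_one, if_neg (Ne.symm hne), π.proj_zero, map_zero,
        ← PsiHom_apply, map_zero, mul_zero, smul_zero]
  rw [sigmaMap, Finset.sum_congr rfl h1, ← Finset.sum_smul, ← Complex.ofReal_sum, hξ,
    Complex.ofReal_one, one_smul]

theorem sigmaMap_mem_crossedSpan (x : L2 H G →L[ℂ] L2 H G) :
    sigmaMap α π ξ x ∈ crossedSpan α :=
  Submodule.sum_mem _ fun _ _ => Submodule.sum_mem _ fun _ _ =>
    Submodule.smul_mem _ _ (leftOp_mul_Psi_mem α _ _)

theorem sigmaMap_Psi_mul (r : R.toStarSubalgebra) (x : L2 H G →L[ℂ] L2 H G) :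
    sigmaMap α π ξ (Psi α r * x) = Psi α r * sigmaMap α π ξ x := by
  simp only [sigmaMap, Finset.mul_sum]
  refine Finset.sum_congr rfl fun g _ => Finset.sum_congr rfl fun h _ => ?_
  rw [entry_Psi_mul, π.proj_coe_mul, map_mul, Psi_mul, mul_smul_comm, ← mul_assoc,
    ← Psi_mul_leftOp, aut_mul_apply, aut_mul_apply, mul_assoc]
  congr 4
  rw [show g * h⁻¹ * h * g⁻¹ = 1 by group, aut_one_apply]

theorem sigmaMap_mul_Psi (r : R.toStarSubalgebra) (x : L2 H G →L[ℂ] L2 H G) :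
    sigmaMap α π ξ (x * Psi α r) = sigmaMap α π ξ x * Psi α r := by
  simp only [sigmaMap, Finset.sum_mul]
  refine Finset.sum_congr rfl fun g _ => Finset.sum_congr rfl fun h _ => ?_
  rw [entry_mul_Psi, π.proj_mul_coe, map_mul, Psi_mul, aut_mul_apply, mul_inv_cancel,
    aut_one_apply, smul_mul_assoc, mul_assoc]

theorem isUCPBimodular_sigmaMap (hξ : ∑ g ∈ ξ.support, ‖ξ g‖ ^ 2 = 1) :
    IsUCPBimodular α (sigmaMap α π ξ) where
  cp := ⟨sigmaCP α π ξ, sigmaCP_apply α π ξ⟩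
  unital := sigmaMap_one α π ξ hξ
  mem x := crossedSpan_subset_crossedProduct α (sigmaMap_mem_crossedSpan α π ξ x)
  left_mod := sigmaMap_Psi_mul α π ξ
  right_mod := sigmaMap_mul_Psi α π ξ

open Classical in
/-- `|S ∩ gS|` counts the pairs `(a, b)` in `S × S` with `a b⁻¹ = g`. -/
theorem card_filter_mul_inv (S : Finset G) (g : G) :
    (((S ×ˢ S).filter fun p => p.1 * p.2⁻¹ = g).card : ℝ) / S.card = chi S g := by
  unfold chi
  congr 2
  refine Finset.card_bij (fun p _ => p.1) ?_ ?_ ?_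
  · rintro ⟨a, b⟩ h
    simp only [Finset.mem_filter, Finset.mem_product] at h
    refine Finset.mem_inter.2 ⟨h.1.1, Finset.mem_smul_finset.2 ⟨b, h.1.2, ?_⟩⟩
    rw [smul_eq_mul, ← h.2]; group
  · rintro ⟨a, b⟩ h ⟨a', b'⟩ h' (rfl : a = a')
    simp only [Finset.mem_filter, Finset.mem_product] at h h'
    have := h.2.trans h'.2.symm
    rw [mul_right_inj, inv_inj] at this
    rw [this]
  · intro a ha
    obtain ⟨h1, h2⟩ := Finset.mem_inter.1 ha
    obtain ⟨b, hb, rfl⟩ := Finset.mem_smul_finset.1 h2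
    refine ⟨(g • b, b), ?_, rfl⟩
    simp only [Finset.mem_filter, Finset.mem_product, smul_eq_mul, mul_inv_cancel_right]
    exact ⟨⟨h1, hb⟩, trivial⟩

/-- On the crossed product `σ_{ξ_S}` multiplies the matrix entry `x_{(s,t)}` by `χ_S(s t⁻¹)`. -/
theorem entry_sigmaMap_xi {S : Finset G} (hS : S.Nonempty) {x : L2 H G →L[ℂ] L2 H G}
    (hx : x ∈ crossedProduct α) (s t : G) :
    entry (sigmaMap α π (xi S) x) s t = (chi S (s * t⁻¹) : ℂ) • entry x s t := by
  classical
  obtain ⟨c, hc⟩ := exists_covariant_entries α hx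
  have hcard : (0 : ℝ) < S.card := by exact_mod_cast hS.card_pos
  have hterm : ∀ g ∈ S, ∀ h ∈ S, entry (((starRingEnd ℂ) (xi S g) * xi S h) •
      (leftOp (g * h⁻¹) * Psi α (α h (π.proj (entry x g h))))) s t =
      if g * h⁻¹ = s * t⁻¹ then ((S.card : ℂ)⁻¹) • entry x s t else 0 := by
    intro g hg h hh
    rw [entry_smul, hc g h, π.proj_coe, aut_mul_apply, mul_inv_cancel, aut_one_apply,
      entry_leftOp_mul_Psi, xi_apply hg, xi_apply hh, hc s t]
    by_cases hgh : g * h⁻¹ = s * t⁻¹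
    · rw [if_pos hgh, if_pos hgh.symm, hgh]
      congr 1
      rw [← Complex.ofReal_inv, Complex.conj_ofReal, ← Complex.ofReal_mul, ← mul_inv,
        Real.mul_self_sqrt hcard.le]
      push_cast; rfl
    · rw [if_neg hgh, if_neg (Ne.symm hgh), smul_zero]
  rw [sigmaMap, xi_support hS, entry_sum]
  simp only [entry_sum]
  rw [Finset.sum_congr rfl fun g hg => Finset.sum_congr rfl fun h hh => hterm g hg h hh,
    ← Finset.sum_product', ← Finset.sum_filter, Finset.sum_const, ← card_filter_mul_inv,
    ← Nat.cast_smul_eq_nsmul ℂ, smul_smul, div_eq_mul_inv]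
  congr 1
  push_cast
  rfl

end SigmaMap

/-! ### Limits of the functions `χ_S` and of the maps `σ_{ξ_S}` -/

section Chi

variable {G : Type*} [Group G]

open Pointwise in
/-- The matrix `(χ_S(g_i⁻¹ g_j))` is the Gram matrix of the vectors `|S|^{-1/2} 1_{g_i S}`. -/
theorem isPositiveDefinite_chi (S : Finset G) : IsPositiveDefinite (fun g => (chi S g : ℂ)) := by
  classical
  intro k g
  let T : Finset G := Finset.univ.biUnion fun i => g i • S
  let A : Matrix T (Fin k) ℂ := Matrix.of fun t i =>
    if (t : G) ∈ g i • S then ((Real.sqrt (S.card : ℝ))⁻¹ : ℂ) else 0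
  have hA : (Matrix.of fun i j => (chi S ((g i)⁻¹ * g j) : ℂ)) = A.conjTranspose * A := by
    ext i j
    have hterm : ∀ t : T, A.conjTranspose i t * A t j =
        if (t : G) ∈ g i • S ∩ g j • S then ((S.card : ℂ)⁻¹) else 0 := by
      intro t
      rw [Matrix.conjTranspose_apply]
      simp only [A, Matrix.of_apply, Finset.mem_inter]
      by_cases h1 : (t : G) ∈ g i • S <;> by_cases h2 : (t : G) ∈ g j • S
      · rw [if_pos h1, if_pos h2, if_pos ⟨h1, h2⟩, ← Complex.ofReal_inv, RCLike.star_def,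
          Complex.conj_ofReal, ← Complex.ofReal_mul, ← mul_inv,
          Real.mul_self_sqrt (Nat.cast_nonneg _)]
        push_cast; rfl
      · simp [h2]
      · simp [h1]
      · simp [h1]
    have hcard : (S ∩ ((g i)⁻¹ * g j) • S).card = (g i • S ∩ g j • S).card := by
      rw [← Finset.card_smul_finset (g i) (S ∩ _), Finset.smul_finset_inter, smul_smul,
        mul_inv_cancel_left]
    have hsub : T.filter (fun t => t ∈ g i • S ∩ g j • S) = g i • S ∩ g j • S := by
      ext t
      rw [Finset.mem_filter]
      refine ⟨fun h => h.2, fun h => ⟨?_, h⟩⟩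
      exact Finset.mem_biUnion.2 ⟨i, Finset.mem_univ _, (Finset.mem_inter.1 h).1⟩
    rw [Matrix.mul_apply, Finset.sum_congr rfl fun t _ => hterm t,
      Finset.sum_coe_sort T fun t => if t ∈ g i • S ∩ g j • S then ((S.card : ℂ)⁻¹) else 0,
      ← Finset.sum_filter, hsub, Finset.sum_const, Matrix.of_apply, nsmul_eq_mul, ← hcard,
      ← div_eq_mul_inv]
    unfold chi
    push_cast
    congr
  rw [hA]
  exact Matrix.posSemidef_conjTranspose_mul_self A

theorem chi_nonneg (S : Finset G) (g : G) : 0 ≤ chi S g := by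
  unfold chi; positivity

theorem chi_le_one (S : Finset G) (g : G) : chi S g ≤ 1 := by
  classical
  unfold chi
  refine div_le_one_of_le₀ ?_ (Nat.cast_nonneg _)
  exact_mod_cast Finset.card_le_card Finset.inter_subset_left

open Classical Pointwise in
theorem chi_one {S : Finset G} (hS : S.Nonempty) : chi S 1 = 1 := by
  have hc : (S.card : ℝ) ≠ 0 := by exact_mod_cast hS.card_pos.ne'
  unfold chi
  rw [one_smul, Finset.inter_self, div_self hc]

open Classical Pointwise in
/-- `χ_S(t) = 1 - |tS Δ S| / (2|S|)`. -/
theorem chi_eq_one_sub {S : Finset G} (hS : S.Nonempty) (t : G) :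
    chi S t = 1 - ((symmDiff (t • S) S).card : ℝ) / (S.card : ℝ) / 2 := by
  have hc : (S.card : ℝ) ≠ 0 := by exact_mod_cast hS.card_pos.ne'
  have h1 : (symmDiff (t • S) S).card = ((t • S) \ S).card + (S \ (t • S)).card := by
    rw [← Finset.card_union_of_disjoint disjoint_sdiff_sdiff]
    rfl
  have h2 := Finset.card_sdiff_add_card_inter (t • S) S
  have h3 := Finset.card_sdiff_add_card_inter S (t • S)
  rw [Finset.card_smul_finset, Finset.inter_comm] at h2
  have e : chi S t = ((S ∩ t • S).card : ℝ) / (S.card : ℝ) := rfl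
  rw [e, h1]
  have h2' : ((((t • S) \ S).card : ℝ)) = S.card - (S ∩ t • S).card := by
    rw [eq_sub_iff_add_eq]; exact_mod_cast h2
  have h3' : (((S \ (t • S)).card : ℝ)) = S.card - (S ∩ t • S).card := by
    rw [eq_sub_iff_add_eq]; exact_mod_cast h3
  push_cast
  rw [h2', h3']
  field_simp
  ring

theorem isPositiveDefinite_of_tendsto {J : Type*} {l : Filter J} [l.NeBot] {f : J → G → ℂ}
    {χ : G → ℂ} (hf : ∀ j, IsPositiveDefinite (f j))
    (h : ∀ g, Tendsto (fun j => f j g) l (𝓝 (χ g))) : IsPositiveDefinite χ := by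
  intro k g
  rw [Matrix.posSemidef_iff_dotProduct_mulVec]
  constructor
  · refine Matrix.IsHermitian.ext fun i j' => ?_
    refine tendsto_nhds_unique (((Complex.continuous_conj.tendsto _).comp (h ((g j')⁻¹ * g i)))) ?_
    refine (h ((g i)⁻¹ * g j')).congr fun j => ?_
    exact ((hf j k g).isHermitian.apply i j').symm
  · intro x
    refine ge_of_tendsto' (f := fun j => dotProduct (star x)
      (Matrix.mulVec (Matrix.of fun i i' => f j ((g i)⁻¹ * g i')) x)) (x := l) ?_ fun j =>
        (Matrix.posSemidef_iff_dotProduct_mulVec.1 (hf j k g)).2 x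
    simp only [dotProduct, Matrix.mulVec, Matrix.of_apply]
    exact tendsto_finsetSum _ fun i _ => (tendsto_finsetSum _ fun i' _ =>
      (h _).mul_const _).const_mul _

end Chi

section Subnet

/-- The pointed members `(A, m)`, `m ∈ A`, of a filter on `ℕ`, ordered by reverse inclusion of the
sets `A`. -/
structure PointedMember (U : Filter ℕ) where
  /-- the member of the filter -/
  set : Set ℕ
  /-- the chosen point -/
  point : ℕ
  set_mem : set ∈ U
  point_mem : point ∈ set

instance (U : Filter ℕ) : Preorder (PointedMember U) :=
  Preorder.lift fun p => OrderDual.toDual p.set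

theorem PointedMember.le_iff {U : Filter ℕ} {p q : PointedMember U} : p ≤ q ↔ q.set ⊆ p.set :=
  Iff.rfl

theorem PointedMember.exists_set_eq {U : Filter ℕ} [U.NeBot] {A : Set ℕ} (hA : A ∈ U) :
    ∃ p : PointedMember U, p.set = A :=
  let ⟨m, hm⟩ := nonempty_of_mem hA
  ⟨⟨A, m, hA, hm⟩, rfl⟩

instance (U : Filter ℕ) [U.NeBot] : IsDirectedOrder (PointedMember U) := ⟨fun p q => by
  obtain ⟨r, hr⟩ := PointedMember.exists_set_eq (inter_mem p.set_mem q.set_mem)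
  refine ⟨r, ?_, ?_⟩
  · rw [PointedMember.le_iff, hr]; exact Set.inter_subset_left
  · rw [PointedMember.le_iff, hr]; exact Set.inter_subset_right⟩

instance (U : Filter ℕ) [U.NeBot] : Nonempty (PointedMember U) :=
  ⟨(PointedMember.exists_set_eq univ_mem).choose⟩

theorem PointedMember.tendsto_point (U : Filter ℕ) [U.NeBot] :
    Tendsto (point : PointedMember U → ℕ) atTop U := by
  intro A hA
  obtain ⟨p, rfl⟩ := exists_set_eq hA
  exact mem_map.2 ((eventually_ge_atTop p).mono fun q hq => hq q.point_mem)

end Subnet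

section FourierSeries

theorem sqrtNorm_sq {K : Type*} [NormedAddCommGroup K] [InnerProductSpace ℂ K] [CompleteSpace K]
    {a : K →L[ℂ] K} (ha : 0 ≤ a) (ξ : K) :
    ((sqrtNorm a ξ ^ 2 : ℝ) : ℂ) = inner ℂ ξ (a ξ) := by
  have h1 : inner ℂ ξ (a ξ) = inner ℂ ξ ((CFC.sqrt a * CFC.sqrt a) ξ) := by
    rw [CFC.sqrt_mul_sqrt_self a ha]
  rw [h1, mul_apply_eq_comp, ← ContinuousLinearMap.adjoint_inner_left,
    ← ContinuousLinearMap.star_eq_adjoint, (CFC.sqrt_nonneg a).isSelfAdjoint.star_eq,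
    inner_self_eq_norm_sq_to_K]
  unfold sqrtNorm
  norm_cast

variable {H : Type*} [NormedAddCommGroup H] [InnerProductSpace ℂ H]
  {G : Type*}

theorem inner_Diag (x : L2 H G →L[ℂ] L2 H G) (ξ : L2 H G) :
    inner ℂ ξ (Diag x ξ) = ∑' t, inner ℂ (ξ t) (entry x t t (ξ t)) := by
  rw [lp.inner_eq_tsum]
  rfl

variable [CompleteSpace H]

open Classical in
theorem inner_entry_star_mul_self (x : L2 H G →L[ℂ] L2 H G) (t : G) (η : H) :
    inner ℂ η (entry (star x * x) t t η) =
      ((‖x (lp.single 2 t η : L2 H G)‖ ^ 2 : ℝ) : ℂ) := by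
  rw [inner_entry, mul_apply_eq_comp, ContinuousLinearMap.star_eq_adjoint,
    ContinuousLinearMap.adjoint_inner_right, inner_self_eq_norm_sq_to_K]
  norm_cast

theorem Diag_star_mul_self_nonneg (x : L2 H G →L[ℂ] L2 H G) : 0 ≤ Diag (star x * x) := by
  classical
  refine nonneg_iff_inner.2 fun ξ => ?_
  simp only [inner_Diag, inner_entry_star_mul_self, ← Complex.ofReal_tsum]
  exact Complex.zero_le_real.2 (tsum_nonneg fun _ => by positivity)

/-- `p_ξ(x)² = ∑_{s,t} ‖x_{(s,t)} ξ_t‖²`. -/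
theorem diagSeminorm_sq (ξ : L2 H G) (x : L2 H G →L[ℂ] L2 H G) :
    diagSeminorm ξ x ^ 2 = ∑' t, ∑' s, ‖entry x s t (ξ t)‖ ^ 2 := by
  classical
  have h1 : ((diagSeminorm ξ x ^ 2 : ℝ) : ℂ) = inner ℂ ξ (Diag (star x * x) ξ) :=
    sqrtNorm_sq (Diag_star_mul_self_nonneg x) ξ
  simp only [inner_Diag, inner_entry_star_mul_self, ← Complex.ofReal_tsum] at h1
  rw [Complex.ofReal_inj.1 h1]
  refine tsum_congr fun t => ?_
  rw [norm_sq_eq_tsum]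
  rfl

variable [Group G]

theorem entry_leftOp_mul_fourierCoeff [DecidableEq G] (x : L2 H G →L[ℂ] L2 H G) (g s t : G) :
    entry (leftOp g * fourierCoeff x g) s t = if s * t⁻¹ = g then entry x s t else 0 := by
  rw [entry_leftOp_mul]
  unfold fourierCoeff Diag
  by_cases h : s * t⁻¹ = g
  · rw [if_pos h]
    obtain rfl : s = g * t := by rw [← h]; group
    rw [inv_mul_cancel_left, entry_diagonalOp_self, star_leftOp, entry_leftOp_mul, inv_inv]
  · rw [if_neg h, entry_diagonalOp_of_ne]
    exact fun h' => h (by rw [← h']; group)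

/-- An operator whose matrix entries are those of `∑_g f(g) L_g x_g` has that Fourier series: the
square of the seminorm of the remainder is the sum of `‖y_{(s,t)} ξ_t‖²` over `s t⁻¹ ∉ F`. -/
theorem hasFourierSeries_of_entry {x y : L2 H G →L[ℂ] L2 H G} {f : G → ℂ}
    (h : ∀ s t, entry y s t = f (s * t⁻¹) • entry x s t) :
    HasFourierSeries y (fun g => f g • fourierCoeff x g) := by
  classical
  intro ξ
  have hentry : ∀ (F : Finset G) (s t : G),
      entry (y - ∑ g ∈ F, leftOp g * f g • fourierCoeff x g) s t =
        if s * t⁻¹ ∈ F then 0 else entry y s t := by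
    intro F s t
    rw [entry_sub, entry_sum]
    simp only [mul_smul_comm, entry_smul, entry_leftOp_mul_fourierCoeff, smul_ite, smul_zero]
    rw [Finset.sum_ite_eq, h]
    split_ifs <;> simp
  have hcol : ∀ t, Summable fun s => ‖entry y s t (ξ t)‖ ^ 2 := fun t =>
    (memlp_two_iff _).1 (lp.memℓp (y (lp.single 2 t (ξ t))))
  have hle : ∀ (F : Finset G) (s t : G),
      ‖(if s * t⁻¹ ∈ F then (0 : H →L[ℂ] H) else entry y s t) (ξ t)‖ ^ 2 ≤
        ‖entry y s t (ξ t)‖ ^ 2 := by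
    intro F s t
    split_ifs
    · simp
    · exact le_rfl
  have hsq : Tendsto (fun F : Finset G =>
      diagSeminorm ξ (y - ∑ g ∈ F, leftOp g * f g • fourierCoeff x g) ^ 2) atTop (𝓝 0) := by
    simp only [diagSeminorm_sq, hentry]
    have hz : (0 : ℝ) = ∑' _ : G, (0 : ℝ) := tsum_zero.symm
    rw [hz]
    refine tendsto_tsum_of_dominated_convergence (bound := fun t => ‖y‖ ^ 2 * ‖ξ t‖ ^ 2)
      (((memlp_two_iff _).1 (lp.memℓp ξ)).mul_left _) (fun t => ?_)
      (Eventually.of_forall fun F t => ?_)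
    · rw [hz]
      refine tendsto_tsum_of_dominated_convergence (hcol t) (fun s => ?_)
        (Eventually.of_forall fun F s => ?_)
      · refine tendsto_const_nhds.congr' ?_
        filter_upwards [eventually_ge_atTop {s * t⁻¹}] with F hF
        rw [if_pos (hF (Finset.mem_singleton_self _))]
        simp
      · rw [Real.norm_of_nonneg (by positivity)]
        exact hle F s t
    · rw [Real.norm_of_nonneg (tsum_nonneg fun _ => sq_nonneg _)]
      calc _ ≤ ∑' s, ‖entry y s t (ξ t)‖ ^ 2 :=
            ((hcol t).of_nonneg_of_le (fun _ => sq_nonneg _) (hle F · t)).tsum_le_tsum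
              (hle F · t) (hcol t)
        _ = ‖y (lp.single 2 t (ξ t))‖ ^ 2 := (norm_sq_eq_tsum _).symm
        _ ≤ (‖y‖ * ‖ξ t‖) ^ 2 := by
            gcongr
            refine (y.le_opNorm _).trans_eq ?_
            rw [lp.norm_single (by norm_num)]
        _ = _ := mul_pow _ _ _
  have := (Real.continuous_sqrt.tendsto 0).comp hsq
  rw [Real.sqrt_zero] at this
  refine this.congr fun F => ?_
  exact Real.sqrt_sq (norm_nonneg _)

end FourierSeries

section Limit

variable {H : Type*} [NormedAddCommGroup H] [InnerProductSpace ℂ H] [CompleteSpace H]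
  {R : VonNeumannAlgebra H} {G : Type*} [Group G]
  {α : G →* (R.toStarSubalgebra ≃⋆ₐ[ℂ] R.toStarSubalgebra)}

theorem IsUCPBimodular.norm_le {T : (L2 H G →L[ℂ] L2 H G) → (L2 H G →L[ℂ] L2 H G)}
    (hT : IsUCPBimodular α T) (x : L2 H G →L[ℂ] L2 H G) : ‖T x‖ ≤ ‖x‖ := by
  obtain ⟨Φ, hΦ⟩ := hT.cp
  rw [← hΦ]
  exact ucp_norm_le Φ ((hΦ 1).trans hT.unital) x

theorem isUCPBimodular_of_tendsto {J : Type*} {l : Filter J} [l.NeBot]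
    {T : J → (L2 H G →L[ℂ] L2 H G) → (L2 H G →L[ℂ] L2 H G)}
    {σ : (L2 H G →L[ℂ] L2 H G) → (L2 H G →L[ℂ] L2 H G)} (hT : ∀ j, IsUCPBimodular α (T j))
    (h : ∀ x, UltraweakTendsto (fun j => T j x) l (σ x)) : IsUCPBimodular α σ where
  cp := by
    choose Φ hΦ using fun j => (hT j).cp
    let σl : (L2 H G →L[ℂ] L2 H G) →ₗ[ℂ] (L2 H G →L[ℂ] L2 H G) :=
      { toFun := σ
        map_add' := fun x y => ext_of_inner fun η ξ =>
          tendsto_nhds_unique ((h (x + y)).tendsto_inner η ξ) (by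
            simpa only [← hΦ, map_add, add_apply, inner_add_right] using
              ((h x).tendsto_inner η ξ).add ((h y).tendsto_inner η ξ))
        map_smul' := fun c x => ext_of_inner fun η ξ =>
          tendsto_nhds_unique ((h (c • x)).tendsto_inner η ξ) (by
            simpa only [← hΦ, map_smul, smul_apply, inner_smul_right, RingHom.id_apply] using
              ((h x).tendsto_inner η ξ).const_mul c) }
    refine ⟨cpOfForm σl fun k M hM ξ => ?_, fun x => rfl⟩
    refine ge_of_tendsto' (tendsto_finsetSum _ fun i _ => tendsto_finsetSum _ fun i' _ =>
      (h (M i i')).tendsto_inner (ξ i) (ξ i')) fun j => ?_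
    simp only [← hΦ]
    exact CStarMatrix.sum_inner_nonneg ((Φ j).map_cstarMatrix_nonneg M hM) ξ
  unital := (h 1).unique (by
    simp only [(hT _).unital]
    exact ultraweakTendsto_of_bounded (C := ‖(1 : L2 H G →L[ℂ] L2 H G)‖) (fun _ => le_rfl)
      fun _ _ => tendsto_const_nhds)
  mem x := (h x).mem_closure fun j => (hT j).mem x
  left_mod r x := (h _).unique (by
    simpa only [(hT _).left_mod] using (h x).mul_left (Psi α r))
  right_mod r x := (h _).unique (by
    simpa only [(hT _).right_mod] using (h x).mul_right (Psi α r))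

theorem eq_smul_of_entry {y : L2 H G →L[ℂ] L2 H G} {f : G → ℂ} {g : G} {r : R.toStarSubalgebra}
    (h : ∀ s t, entry y s t = f (s * t⁻¹) • entry (leftOp g * Psi α r) s t) :
    y = f g • (leftOp g * Psi α r) := by
  classical
  refine ext_entry fun s t => ?_
  rw [h, entry_smul, entry_leftOp_mul_Psi]
  by_cases hg : s * t⁻¹ = g
  · rw [hg]
  · rw [if_neg hg, smul_zero, smul_zero]

/-- Contractions that converge in norm on the generators `L_g Ψ(r)` converge in norm on the closed
linear span. -/
theorem tendsto_of_mem_closure_crossedSpan {J : Type*} {l : Filter J}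
    {T : J → (L2 H G →L[ℂ] L2 H G) → (L2 H G →L[ℂ] L2 H G)}
    {σ : (L2 H G →L[ℂ] L2 H G) → (L2 H G →L[ℂ] L2 H G)} (hT : ∀ j, IsUCPBimodular α (T j))
    (hσ : IsUCPBimodular α σ)
    (h : ∀ g r, Tendsto (fun j => T j (leftOp g * Psi α r)) l (𝓝 (σ (leftOp g * Psi α r))))
    {x : L2 H G →L[ℂ] L2 H G} (hx : x ∈ closure (crossedSpan α : Set (L2 H G →L[ℂ] L2 H G))) :
    Tendsto (fun j => T j x) l (𝓝 (σ x)) := by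
  choose Φ hΦ using fun j => (hT j).cp
  obtain ⟨Θ, hΘ⟩ := hσ.cp
  have hspan : ∀ y ∈ crossedSpan α, Tendsto (fun j => T j y) l (𝓝 (σ y)) := by
    intro y hy
    unfold crossedSpan at hy
    induction hy using Submodule.span_induction with
    | mem y hy => obtain ⟨g, r, rfl⟩ := hy; exact h g r
    | zero => simp only [← hΦ, ← hΘ, map_zero]; exact tendsto_const_nhds
    | add y z _ _ hy hz =>
      simp only [← hΦ, ← hΘ, map_add] at hy hz ⊢
      exact hy.add hz
    | smul c y _ hy =>
      simp only [← hΦ, ← hΘ, map_smul] at hy ⊢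
      exact hy.const_smul c
  rw [Metric.tendsto_nhds]
  intro ε hε
  obtain ⟨y, hy, hxy⟩ := Metric.mem_closure_iff.1 hx (ε / 3) (by positivity)
  filter_upwards [Metric.tendsto_nhds.1 (hspan y hy) (ε / 3) (by positivity)] with j hj
  have h1 : dist (T j x) (T j y) ≤ dist x y := by
    rw [dist_eq_norm, dist_eq_norm, ← hΦ, ← hΦ, ← map_sub, hΦ]
    exact (hT j).norm_le _
  have h2 : dist (σ y) (σ x) ≤ dist x y := by
    rw [dist_comm, dist_eq_norm, dist_eq_norm, ← hΘ, ← hΘ, ← map_sub, hΘ]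
    exact hσ.norm_le _
  linarith [dist_triangle4 (T j x) (T j y) (σ y) (σ x)]

/-- A bimodular unital completely positive map that is the identity on the crossed product has the
crossed product in its multiplicative domain. -/
theorem IsUCPBimodular.isCondExp {T : (L2 H G →L[ℂ] L2 H G) → (L2 H G →L[ℂ] L2 H G)}
    (hT : IsUCPBimodular α T) (h : ∀ x ∈ crossedProduct α, T x = x) : IsCondExp α T where
  cp := hT.cp
  mem := hT.mem
  map_of_mem := h
  bimodular a ha b hb x := by
    obtain ⟨Φ, hΦ⟩ := hT.cp
    have h1 : Φ 1 = 1 := (hΦ 1).trans hT.unital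
    have hfix : ∀ y ∈ crossedProduct α, Φ y = y := fun y hy => (hΦ y).trans (h y hy)
    simp only [← hΦ]
    rw [mul_assoc, cp_map_mul_of_map_mul_star_self Φ h1, cp_map_mul_of_map_star_mul_self Φ h1,
      hfix a ha, hfix b hb, mul_assoc]
    · rw [hfix b hb, hfix _ (mul_mem_crossedProduct α (star_mem_crossedProduct α hb) hb)]
    · rw [hfix a ha, hfix _ (mul_mem_crossedProduct α ha (star_mem_crossedProduct α ha))]

end Limit

end CrossedProd

/-! ### Subnets of `(σ_{ξ_n})` -/

open CrossedProd in
theorem mainTheorem3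
    {H : Type*} [NormedAddCommGroup H] [InnerProductSpace ℂ H] [CompleteSpace H]
    {G : Type*} [Group G]
    (R : VonNeumannAlgebra H)
    (α : G →* (R.toStarSubalgebra ≃⋆ₐ[ℂ] R.toStarSubalgebra))
    (π : CPProjection R)
    (B : ℕ → Finset G) (hB : ∀ n, (B n).Nonempty) :
    -- the functions `χ_{B_n}` are positive definite, the maps `σ_{ξ_n}` are unital, CP, bimodular
    (∀ n, IsPositiveDefinite (fun g => (chi (B n) g : ℂ))) ∧
    (∀ n, IsUCPBimodular α (sigmaMap α π (xi (B n)))) ∧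
    -- there is a subnet
    ∃ (J : Type) (_ : Preorder J) (_ : IsDirectedOrder J) (_ : Nonempty J) (n : J → ℕ),
      Tendsto n atTop atTop ∧
      ∃ (χ : G → ℝ) (σ : (L2 H G →L[ℂ] L2 H G) → (L2 H G →L[ℂ] L2 H G)),
        -- pointwise convergence to `χ`
        (∀ g, Tendsto (fun ι => chi (B (n ι)) g) atTop (𝓝 (χ g))) ∧
        IsPositiveDefinite (fun g => (χ g : ℂ)) ∧ (∀ g, 0 ≤ χ g) ∧ χ 1 = 1 ∧
        -- point-ultraweak convergence to `σ`
        (∀ x, UltraweakTendsto (fun ι => sigmaMap α π (xi (B (n ι))) x) atTop (σ x)) ∧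
        IsUCPBimodular α σ ∧
        -- (i)
        (∀ (g : G) (r : R.toStarSubalgebra),
          σ (leftOp g * Psi α r) = (χ g : ℂ) • (leftOp g * Psi α r)) ∧
        -- (ii)
        (∀ x ∈ crossedProduct α, IsHadamardMultiple α (fun g => (χ g : ℂ)) x (σ x)) ∧
        -- (iii)
        (∀ x ∈ closure (crossedSpan α : Set (L2 H G →L[ℂ] L2 H G)),
          Tendsto (fun ι => sigmaMap α π (xi (B (n ι))) x) atTop (𝓝 (σ x))) ∧
        -- the amenable case
        (IsFolnerSeq B → (∀ g, χ g = 1) ∧ IsCondExp α σ) := by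
  classical
  have hucp : ∀ n, IsUCPBimodular α (sigmaMap α π (xi (B n))) := fun n =>
    isUCPBimodular_sigmaMap α π _ (xi_norm (hB n))
  refine ⟨fun n => isPositiveDefinite_chi (B n), hucp, ?_⟩
  let U : Ultrafilter ℕ := Ultrafilter.of atTop
  have hU : (U : Filter ℕ) ≤ atTop := Ultrafilter.of_le _
  -- limits of all the nets along a fixed ultrafilter
  have hχ : ∀ g, ∃ c : ℝ, Tendsto (fun n => chi (B n) g) U (𝓝 c) := fun g => by
    obtain ⟨c, -, hc⟩ := (isCompact_Icc (a := (0 : ℝ)) (b := 1)).ultrafilter_le_nhds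
      (U.map fun n => chi (B n) g) (le_principal_iff.2 (Eventually.of_forall (f := (U : Filter ℕ))
        fun n => ⟨chi_nonneg (B n) g, chi_le_one (B n) g⟩))
    exact ⟨c, hc⟩
  have hσ : ∀ x, ∃ y, UltraweakTendsto (fun n => sigmaMap α π (xi (B n)) x) U y := fun x =>
    exists_ultraweakTendsto U fun n => (hucp n).norm_le x
  choose χ hχ using hχ
  choose σ hσ using hσ
  have hχℂ : ∀ g, Tendsto (fun n => (chi (B n) g : ℂ)) U (𝓝 (χ g : ℂ)) := fun g =>
    (Complex.continuous_ofReal.tendsto _).comp (hχ g)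
  have hσucp : IsUCPBimodular α σ := isUCPBimodular_of_tendsto hucp hσ
  have hentry : ∀ x ∈ crossedProduct α, ∀ s t,
      entry (σ x) s t = (χ (s * t⁻¹) : ℂ) • entry x s t := fun x hx s t =>
    ext_of_inner fun η ξ => tendsto_nhds_unique ((hσ x).tendsto_inner_entry s t η ξ) (by
      simp only [entry_sigmaMap_xi α π (hB _) hx, smul_apply, inner_smul_right]
      exact (hχℂ _).mul_const _)
  have hgen : ∀ (g : G) (r : R.toStarSubalgebra), leftOp g * Psi α r ∈ crossedProduct α :=
    fun g r => crossedSpan_subset_crossedProduct α (leftOp_mul_Psi_mem α g r)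
  have hi : ∀ (g : G) (r : R.toStarSubalgebra),
      σ (leftOp g * Psi α r) = (χ g : ℂ) • (leftOp g * Psi α r) := fun g r =>
    eq_smul_of_entry (f := fun h => (χ h : ℂ)) (hentry _ (hgen g r))
  have hn := PointedMember.tendsto_point (U : Filter ℕ)
  refine ⟨PointedMember (U : Filter ℕ), inferInstance, inferInstance, inferInstance,
    PointedMember.point, hn.mono_right hU, χ, σ, fun g => (hχ g).comp hn,
    isPositiveDefinite_of_tendsto (fun n => isPositiveDefinite_chi (B n)) hχℂ,
    fun g => ge_of_tendsto' (hχ g) fun n => chi_nonneg (B n) g, ?_,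
    fun x => (hσ x).comp hn, hσucp, hi,
    fun x hx => ⟨hσucp.mem x, hasFourierSeries_of_entry (hentry x hx)⟩,
    fun x hx => ?_, fun hF => ?_⟩
  · refine tendsto_nhds_unique (hχ 1) (tendsto_const_nhds.congr fun n => ?_)
    rw [chi_one (hB n)]
  · refine tendsto_of_mem_closure_crossedSpan (fun p => hucp _) hσucp (fun g r => ?_) hx
    have hn' : ∀ n, sigmaMap α π (xi (B n)) (leftOp g * Psi α r) =
        (chi (B n) g : ℂ) • (leftOp g * Psi α r) := fun n =>
      eq_smul_of_entry (f := fun h => (chi (B n) h : ℂ))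
        (entry_sigmaMap_xi α π (hB n) (hgen g r))
    simp only [hn', hi]
    exact ((hχℂ g).comp hn).smul_const _
  · have h1 : ∀ g, χ g = 1 := fun g => by
      have h2 : Tendsto (fun n => chi (B n) g) atTop (𝓝 (1 - 0 / 2)) := by
        simp only [chi_eq_one_sub (hB _)]
        exact ((hF g).div_const 2).const_sub 1
      rw [zero_div, sub_zero] at h2
      exact tendsto_nhds_unique (hχ g) (h2.mono_left hU)
    refine ⟨h1, hσucp.isCondExp fun x hx => ext_entry fun s t => ?_⟩
    rw [hentry x hx, h1, Complex.ofReal_one, one_smul]
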